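/- Fix a nonzero window $\phi\in\mathcal S(\mathbb R^n)$. For $f\in\mathcal S'(\mathbb R^n)$ let $V_\phi f(x,\xi)=(2\pi)^{-n/2}\langle f,\overline{\phi(\cdot-x)}\,e^{-i(\cdot)\cdot\xi}\rangle$ be its short-time Fourier transform, and for $s\in\mathbb R$, $1\le p,q\le\infty$ let $M^s_{p,q}$ be the space of all $f\in\mathcal S'(\mathbb R^n)$ with $$\|f\|_{M^s_{p,q}}=\Big\|\,\xi\mapsto\big\|\,x\mapsto V_\phi f(x,\xi)\,(1+|\xi|^2)^{s/2}\big\|_{L^p(\mathbb R^n)}\Big\|_{L^q(\mathbb R^n)}<\infty .$$ For $\psi\in C_0^\infty(\mathbb R^n)$ with $\psi=1$ in a neighbourhood of the origin put $S^jf=\mathcal F^{-1}[\psi(2^{-j}\cdot)\,\mathcal Ff]$, $j=0,1,2,\dots$ (a smooth function of temperate growth), where $\mathcal F\varphi(\xi)=(2\pi)^{-n/2}\int_{\mathbb R^n} e^{ix\cdot\xi}\varphi(x)\,dx$. The product of $f,g\in\mathcal S'$ is $f\cdot g=\lim_{j\to\infty}S^jf\cdot S^jg$, whenever this limit exists in $\mathcal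 S'$ with its weak topology. Theorem. Let $1\le p,p_1,p_2,q\le\infty$ with $1/p=1/p_1+1/p_2$, and let $s\le0$. Then there exists a constant $c$ such that for all $f\in M^{|s|}_{p_1,1}$ and $g\in M^s_{p_2,q}$ the product $f\cdot g$ exists in $\mathcal S'$ and does not depend on the choice of $\psi$, it belongs to $M^s_{p,q}$, and $$\|f\cdot g\|_{M^s_{p,q}}\le c\,\|f\|_{M^{|s|}_{p_1,1}}\,\|g\|_{M^s_{p_2,q}} .$$ In particular, for every $1\le p\le\infty$ the Dirac distribution $\delta$ (at the origin) belongs to $M^0_{p,\infty}$, and there is a constant $c$ such that for all $f\in M^0_{\infty,1}$ the product $f\cdot\delta$ exists in $\mathcal S'$ independently of the choice of $\psi$, belongs to $M^0_{p,\infty}$, and satisfies $\|f\cdot\delta\|_{M^0_{p,\infty}}\le c\,\|\delta\|_{M^0_{p,\infty}}\,\|f\|_{M^0_{\infty,1}}$. -/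

import Mathlib

open MeasureTheory Filter Topology SchwartzMap
open scoped ENNReal NNReal

noncomputable section

namespace ModulationSpace

/-- `ℝⁿ` with the Euclidean norm. -/
abbrev Rn (n : ℕ) : Type := EuclideanSpace ℝ (Fin n)

/-- The Japanese bracket `⟨ξ⟩ = (1 + |ξ|²)^{1/2}`. -/
def bracket {n : ℕ} (ξ : Rn n) : ℝ := Real.sqrt (1 + ‖ξ‖ ^ 2)

/-- The plane wave `t ↦ e^{-i t·ξ}`. -/
def planeWave {n : ℕ} (ξ : Rn n) : Rn n → ℂ :=
  fun t ↦ Complex.exp (-Complex.I * ((inner ℝ t ξ : ℝ) : ℂ))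

lemma hasTemperateGrowth_exp_neg_I_mul :
    Function.HasTemperateGrowth (fun t : ℝ ↦ Complex.exp (-Complex.I * (t : ℂ))) := by
  have hd : ∀ t : ℝ, HasDerivAt (fun t : ℝ ↦ Complex.exp (-Complex.I * (t : ℂ)))
      (-Complex.I * Complex.exp (-Complex.I * (t : ℂ))) t := by
    intro t
    have h1 : HasDerivAt (fun t : ℝ ↦ -Complex.I * (t : ℂ)) (-Complex.I) t := by
      simpa using (Complex.ofRealCLM.hasDerivAt (x := t)).const_mul (-Complex.I)
    simpa [mul_comm] using h1.cexp
  have hit : ∀ k : ℕ, iteratedDeriv k (fun t : ℝ ↦ Complex.exp (-Complex.I * (t : ℂ))) =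
      fun t : ℝ ↦ (-Complex.I) ^ k * Complex.exp (-Complex.I * (t : ℂ)) := by
    intro k
    induction k with
    | zero => simp
    | succ k ih =>
      rw [iteratedDeriv_succ, ih]
      funext t
      rw [((hd t).const_mul ((-Complex.I) ^ k)).deriv]
      ring
  refine ⟨?_, fun k ↦ ⟨0, 1, fun t ↦ ?_⟩⟩
  · exact (contDiff_const.mul Complex.ofRealCLM.contDiff).cexp
  · rw [norm_iteratedFDeriv_eq_norm_iteratedDeriv, hit]
    simp [Complex.norm_exp]

lemma planeWave_hasTemperateGrowth {n : ℕ} (ξ : Rn n) :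
    (planeWave ξ).HasTemperateGrowth :=
  hasTemperateGrowth_exp_neg_I_mul.comp
    (f := fun t : Rn n ↦ (inner ℝ t ξ : ℝ)) (by fun_prop)

/-- The Schwartz function `t ↦ conj (φ (t - x)) · e^{-i t·ξ}`. -/
def timeFreqShift {n : ℕ} (φ : 𝓢(Rn n, ℂ)) (x ξ : Rn n) : 𝓢(Rn n, ℂ) :=
  SchwartzMap.smulLeftCLM ℂ (planeWave ξ)
    ((φ.compSubConstCLM ℝ x).postcompCLM (Complex.conjCLE : ℂ →L[ℝ] ℂ))

lemma timeFreqShift_apply {n : ℕ} (φ : 𝓢(Rn n, ℂ)) (x ξ t : Rn n) :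
    timeFreqShift φ x ξ t =
      starRingEnd ℂ (φ (t - x)) * Complex.exp (-Complex.I * ((inner ℝ t ξ : ℝ) : ℂ)) := by
  simp [timeFreqShift, SchwartzMap.smulLeftCLM_apply_apply (planeWave_hasTemperateGrowth ξ),
    planeWave, mul_comm]

/-- The short-time Fourier transform of a tempered distribution `f` with window `φ`,
`V_φ f (x, ξ) = (2π)^{-n/2} ⟨f, conj (φ (· - x)) e^{-i (·)·ξ}⟩` (bilinear pairing). -/
def stft {n : ℕ} (φ : 𝓢(Rn n, ℂ)) (f : 𝓢'(Rn n, ℂ)) (x ξ : Rn n) : ℂ :=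
  (((2 * Real.pi) ^ (-(n : ℝ) / 2) : ℝ) : ℂ) * f (timeFreqShift φ x ξ)

/-- The (extended) norm of `M^s_{p,q}` with respect to the window `φ`: the `L^q` norm in `ξ` of the
`L^p` norm in `x` of `V_φ f (x, ξ) ⟨ξ⟩^s`. -/
def modNorm {n : ℕ} (φ : 𝓢(Rn n, ℂ)) (s : ℝ) (p q : ℝ≥0∞) (f : 𝓢'(Rn n, ℂ)) : ℝ≥0∞ :=
  eLpNorm (fun ξ : Rn n ↦
    eLpNorm (fun x : Rn n ↦ stft φ f x ξ * ((bracket ξ ^ s : ℝ) : ℂ)) p volume) q volume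

/-- Membership in the modulation space `M^s_{p,q}` (with window `φ`). -/
def MemMod {n : ℕ} (φ : 𝓢(Rn n, ℂ)) (s : ℝ) (p q : ℝ≥0∞) (f : 𝓢'(Rn n, ℂ)) : Prop :=
  modNorm φ s p q f < ∞

/-- `ψ ∈ C_0^∞(ℝⁿ)` with `ψ = 1` in a neighbourhood of the origin. -/
structure IsCutoff {n : ℕ} (ψ : Rn n → ℂ) : Prop where
  contDiff : ContDiff ℝ (⊤ : ℕ∞) ψ
  hasCompactSupport : HasCompactSupport ψ
  eventually_eq_one : ∀ᶠ ξ in 𝓝 (0 : Rn n), ψ ξ = 1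

/-- `S^j f = ℱ⁻¹ [ψ (2^{-j} ξ) ℱ f (ξ)]`, for the Fourier transform normalized as
`ℱ f (ξ) = (2π)^{-n/2} ∫ e^{i x·ξ} f (x) dx`. Mathlib's Fourier transform has the kernel
`e^{-2π i x·w}`, so that `ξ = -2π w`. -/
def lowPass {n : ℕ} (ψ : Rn n → ℂ) (j : ℕ) (f : 𝓢'(Rn n, ℂ)) : 𝓢'(Rn n, ℂ) :=
  TemperedDistribution.fourierMultiplierCLM ℂ
    (fun w : Rn n ↦ ψ (((2 : ℝ) ^ j)⁻¹ • (-(2 * Real.pi)) • w)) f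

/-- `h` is the product `f · g = lim_j S^j f · S^j g` in `𝒮'` (weak topology), where `S^j` is formed
with `ψ`. The distributions `S^j f` and `S^j g` are given by smooth functions `u j` and `v j` of
temperate growth, and `S^j f · S^j g` is the distribution given by the function `u j * v j`. -/
def IsProduct {n : ℕ} (ψ : Rn n → ℂ) (f g h : 𝓢'(Rn n, ℂ)) : Prop :=
  ∃ (u v : ℕ → Rn n → ℂ) (hu : ∀ j, (u j).HasTemperateGrowth)
    (hv : ∀ j, (v j).HasTemperateGrowth),
    (∀ j, lowPass ψ j f = (hu j).toTemperedDistribution) ∧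
    (∀ j, lowPass ψ j g = (hv j).toTemperedDistribution) ∧
    Tendsto (fun j ↦ ((hu j).mul (hv j)).toTemperedDistribution) atTop (𝓝 h)

end ModulationSpace

end

/-! Up to a constant, a tempered distribution is the superposition of the atoms a_z(t) = φ(t - y)
e^{i t·η}, z = (y, η), with coefficients V_φ f(z) (`exists_stft_inversion`). The product should
therefore be the double integral of V_φ f(z) V_φ g(z') a_z a_{z'}. Testing a_z a_{z'} against the
window shifted to (x, ξ) gives a quantity bounded, for every N, by the product of the weights (1 +
|·|)^{-N} at y - x, y' - x and η + η' - ξ (`exists_norm_triple_timeFreqShift_le`). Hence |V_φ(f·g)|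
is dominated by `majorant`: a smeared pointwise product in position and a smeared convolution in
frequency of |V_φ f| and |V_φ g|.

The norm estimate then concerns nonnegative functions only (`exists_mixedNorm_majorant_le`). In
position, Minkowski and Hölder use 1/p = 1/p₁ + 1/p₂. In frequency, L¹ convolves L^q into L^q, and
for s ≤ 0 the weight splits as ⟨ξ⟩^s ≲ ⟨η⟩^{|s|} ⟨η'⟩^s up to powers of 1 + |η + η' - ξ|
(`bracket_rpow_le`), which the decay absorbs.

The same estimate gives existence. A finite mixed norm makes the majorant finite at some point,
hence at the origin (`majorant_zero_lt_top`), and this is absolute convergence of the double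
integral against every Schwartz function. Passing from f, g to S^j f, S^j g replaces each atom by
its average over a kernel of mass one at scale 2^{-j}. The averaged pairings obey the same decay
uniformly in j (`exists_norm_tripleSmooth_le`), so dominated convergence yields the limit, in which
ψ no longer appears.

For the Dirac distribution, |V_φ δ(x, ξ)| is a constant times |φ(-x)|, independent of ξ, so δ lies
in M^0_{p,∞}; the last claim is the case s = 0, p₁ = q = ∞. -/

open FourierTransform

noncomputable section

namespace ModulationSpace

/-! ### Polynomial weights and Peetre's inequality. -/

section Weight

variable {E : Type*} [NormedAddCommGroup E]

/-- The polynomial weight `(1 + ‖x‖)^{-N}`. -/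
def wt (N : ℕ) (x : E) : ℝ := ((1 + ‖x‖) ^ N)⁻¹

lemma wt_pos (N : ℕ) (x : E) : 0 < wt N x := by unfold wt; positivity

lemma wt_nonneg (N : ℕ) (x : E) : 0 ≤ wt N x := (wt_pos N x).le

lemma wt_neg (N : ℕ) (x : E) : wt N (-x) = wt N x := by simp [wt]

lemma pow_mul_wt (N : ℕ) (x : E) : (1 + ‖x‖) ^ N * wt N x = 1 := by
  unfold wt
  exact mul_inv_cancel₀ (by positivity)

lemma pow_mul_wt_add (N k : ℕ) (x : E) : (1 + ‖x‖) ^ N * wt (N + k) x = wt k x := by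
  unfold wt
  rw [pow_add, mul_inv, ← mul_assoc, mul_inv_cancel₀ (by positivity), one_mul]

lemma one_add_norm_pow_add_le (N : ℕ) (x y : E) :
    (1 + ‖x + y‖) ^ N ≤ (1 + ‖x‖) ^ N * (1 + ‖y‖) ^ N := by
  rw [← mul_pow]
  gcongr
  nlinarith [norm_add_le x y, mul_nonneg (norm_nonneg x) (norm_nonneg y)]

/-- Peetre's inequality, from submultiplicativity of 1 + |·|. It moves a weight to another centre at
polynomial cost in the displacement, and is used whenever decay must be transferred. -/
lemma wt_le_pow_mul_wt_add (N : ℕ) (x y : E) : wt N x ≤ (1 + ‖y‖) ^ N * wt N (x + y) := by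
  unfold wt
  rw [← div_eq_mul_inv, inv_le_comm₀ (by positivity) (by positivity), inv_div,
    div_le_iff₀ (by positivity)]
  exact one_add_norm_pow_add_le N x y

lemma continuous_wt (N : ℕ) : Continuous (wt N : E → ℝ) := by
  unfold wt
  exact Continuous.inv₀ (by fun_prop) fun x ↦ by positivity

lemma le_mul_wt_iff (N : ℕ) (x : E) (a b : ℝ) : a ≤ b * wt N x ↔ (1 + ‖x‖) ^ N * a ≤ b := by
  unfold wt
  rw [← div_eq_mul_inv, le_div_iff₀ (by positivity), mul_comm]

end Weight

/-! ### Quantitative form of continuity on the Schwartz space. -/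

section Seminorms

variable {E : Type*} [NormedAddCommGroup E] [NormedSpace ℝ E]
  {F : Type*} [NormedAddCommGroup F] [NormedSpace ℝ F] [NormedSpace ℂ F] [SMulCommClass ℝ ℂ F]

/-- The supremum of the Schwartz seminorms of index at most `(m, m)`. -/
def schwartzSup (m : ℕ) (G : 𝓢(E, F)) : ℝ :=
  (Finset.Iic (m, m)).sup (schwartzSeminormFamily ℂ E F) G

lemma schwartzSup_nonneg (m : ℕ) (G : 𝓢(E, F)) : 0 ≤ schwartzSup m G := apply_nonneg _ _

lemma seminorm_le_schwartzSup {m k l : ℕ} (hk : k ≤ m) (hl : l ≤ m) (G : 𝓢(E, F)) :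
    SchwartzMap.seminorm ℂ k l G ≤ schwartzSup m G := by
  have h : (k, l) ∈ Finset.Iic (m, m) := by simp [hk, hl]
  exact (Finset.le_sup (f := schwartzSeminormFamily ℂ E F) h : _) G

lemma schwartzSup_le {m : ℕ} {G : 𝓢(E, F)} {B : ℝ} (hB : 0 ≤ B)
    (h : ∀ k ≤ m, ∀ l ≤ m, SchwartzMap.seminorm ℂ k l G ≤ B) : schwartzSup m G ≤ B := by
  refine Seminorm.finset_sup_apply_le hB fun i hi ↦ ?_
  obtain ⟨h1, h2⟩ : i.1 ≤ m ∧ i.2 ≤ m := by simpa [Prod.le_def] using hi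
  exact h _ h1 _ h2

lemma finset_sup_le_schwartzSup (s : Finset (ℕ × ℕ)) :
    ∃ m, ∀ G : 𝓢(E, F), s.sup (schwartzSeminormFamily ℂ E F) G ≤ schwartzSup m G := by
  refine ⟨s.sup fun i ↦ max i.1 i.2, fun G ↦
    Seminorm.finset_sup_apply_le (schwartzSup_nonneg _ _) fun i hi ↦ ?_⟩
  have := Finset.le_sup (f := fun i : ℕ × ℕ ↦ max i.1 i.2) hi
  exact seminorm_le_schwartzSup ((le_max_left _ _).trans this) ((le_max_right _ _).trans this) G

lemma pow_mul_norm_iteratedFDeriv_le {m k l : ℕ} (hk : k ≤ m) (hl : l ≤ m) (G : 𝓢(E, F)) (t : E) :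
    (1 + ‖t‖) ^ k * ‖iteratedFDeriv ℝ l G t‖ ≤ 2 ^ m * schwartzSup m G :=
  SchwartzMap.one_add_le_sup_seminorm_apply (𝕜 := ℂ) (m := (m, m)) hk hl G t

lemma norm_iteratedFDeriv_le_wt {m k l : ℕ} (hk : k ≤ m) (hl : l ≤ m) (G : 𝓢(E, F)) (t : E) :
    ‖iteratedFDeriv ℝ l G t‖ ≤ 2 ^ m * schwartzSup m G * wt k t :=
  (le_mul_wt_iff _ _ _ _).2 (pow_mul_norm_iteratedFDeriv_le hk hl G t)

lemma norm_le_wt (m : ℕ) (G : 𝓢(E, F)) (t : E) :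
    ‖G t‖ ≤ 2 ^ m * schwartzSup m G * wt m t := by
  simpa using norm_iteratedFDeriv_le_wt (k := m) (l := 0) le_rfl (Nat.zero_le m) G t

lemma schwartzSup_le_of_pow {m : ℕ} {G : 𝓢(E, F)} {B : ℝ} (hB : 0 ≤ B)
    (h : ∀ l ≤ m, ∀ t, (1 + ‖t‖) ^ m * ‖iteratedFDeriv ℝ l G t‖ ≤ B) : schwartzSup m G ≤ B := by
  refine schwartzSup_le hB fun k hk l hl ↦ SchwartzMap.seminorm_le_bound ℂ k l G hB fun t ↦ ?_
  refine le_trans ?_ (h l hl t)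
  gcongr
  calc ‖t‖ ^ k ≤ (1 + ‖t‖) ^ k := by gcongr; linarith
    _ ≤ (1 + ‖t‖) ^ m := by
      have : 1 ≤ 1 + ‖t‖ := by linarith [norm_nonneg t]
      gcongr

variable {F' : Type*} [NormedAddCommGroup F'] [NormedSpace ℝ F'] [NormedSpace ℂ F']
  [SMulCommClass ℝ ℂ F']

lemma continuous_schwartzSup (m : ℕ) : Continuous (schwartzSup m : 𝓢(E, F) → ℝ) := by
  let q : Seminorm ℂ 𝓢(E, F) := (Finset.Iic (m, m)).sup (schwartzSeminormFamily ℂ E F)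
  have h : Continuous q := by
    refine Seminorm.continuous_of_le
      (q := ∑ i ∈ Finset.Iic (m, m), schwartzSeminormFamily ℂ E F i)
      ?_ (Seminorm.finset_sup_le_sum _ _)
    simp only [FunLike.coe_sum, Finset.sum_fn]
    exact continuous_finsetSum _ fun i _ ↦ (schwartz_withSeminorms ℂ E F).continuous_seminorm i
  exact h

lemma exists_schwartzSup_le (A : 𝓢(E, F) →L[ℂ] 𝓢(E, F')) (m : ℕ) :
    ∃ (m' : ℕ) (C : ℝ), 0 ≤ C ∧ ∀ G, schwartzSup m (A G) ≤ C * schwartzSup m' G := by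
  let q : Seminorm ℂ 𝓢(E, F) :=
    ((Finset.Iic (m, m)).sup (schwartzSeminormFamily ℂ E F')).comp A.toLinearMap
  have hq : Continuous q := (continuous_schwartzSup (E := E) (F := F') m).comp A.continuous
  obtain ⟨s, C, -, hC⟩ := Seminorm.bound_of_continuous (schwartz_withSeminorms ℂ E F) q hq
  obtain ⟨m', hm'⟩ := finset_sup_le_schwartzSup (E := E) (F := F) s
  exact ⟨m', C, C.2, fun G ↦ (hC G).trans (mul_le_mul_of_nonneg_left (hm' G) C.2)⟩

/-- A tempered distribution has finite order. -/
lemma exists_norm_le_schwartzSup (f : 𝓢'(E, ℂ)) :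
    ∃ (m : ℕ) (C : ℝ), 0 ≤ C ∧ ∀ G, ‖f G‖ ≤ C * schwartzSup m G := by
  let q : Seminorm ℂ 𝓢(E, ℂ) := (normSeminorm ℂ ℂ).comp f.toLinearMap
  have hq : Continuous q := continuous_norm.comp f.continuous
  obtain ⟨s, C, -, hC⟩ := Seminorm.bound_of_continuous (schwartz_withSeminorms ℂ E ℂ) q hq
  obtain ⟨m', hm'⟩ := finset_sup_le_schwartzSup (E := E) (F := ℂ) s
  exact ⟨m', C, C.2, fun G ↦ (hC G).trans (mul_le_mul_of_nonneg_left (hm' G) C.2)⟩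

end Seminorms

/-! ### Translations and products of Schwartz functions. -/

section Translation

variable {E : Type*} [NormedAddCommGroup E] [NormedSpace ℝ E]

/-- Translation `G ↦ G (· - y)` of Schwartz functions. -/
abbrev trans (y : E) (G : 𝓢(E, ℂ)) : 𝓢(E, ℂ) := G.compSubConstCLM ℂ y

lemma iteratedFDeriv_trans (l : ℕ) (y : E) (G : 𝓢(E, ℂ)) (t : E) :
    iteratedFDeriv ℝ l (trans y G) t = iteratedFDeriv ℝ l G (t - y) :=
  iteratedFDeriv_comp_sub (f := G) l y t

lemma schwartzSup_trans_le (m : ℕ) (y : E) (G : 𝓢(E, ℂ)) :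
    schwartzSup m (trans y G) ≤ 2 ^ m * (1 + ‖y‖) ^ m * schwartzSup m G := by
  have := schwartzSup_nonneg m G
  refine schwartzSup_le_of_pow (by positivity) fun l hl t ↦ ?_
  rw [iteratedFDeriv_trans]
  have h1 := pow_mul_norm_iteratedFDeriv_le le_rfl hl G (t - y)
  have h2 := one_add_norm_pow_add_le m (t - y) y
  rw [sub_add_cancel] at h2
  calc _ ≤ (1 + ‖t - y‖) ^ m * (1 + ‖y‖) ^ m * ‖iteratedFDeriv ℝ l (⇑G) (t - y)‖ := by gcongr
    _ = (1 + ‖y‖) ^ m * ((1 + ‖t - y‖) ^ m * ‖iteratedFDeriv ℝ l (⇑G) (t - y)‖) := by ring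
    _ ≤ (1 + ‖y‖) ^ m * (2 ^ m * schwartzSup m G) := by gcongr
    _ = _ := by ring

/-- Mean value inequality for the l-th derivative on the unit ball around t, where the decay weights
at all points are comparable. -/
lemma seminorm_trans_sub_le (k l : ℕ) (G : 𝓢(E, ℂ)) :
    ∃ C, 0 ≤ C ∧ ∀ y : E, ‖y‖ ≤ 1 → SchwartzMap.seminorm ℂ k l (trans y G - G) ≤ C * ‖y‖ := by
  -- Bounding the increment of the l-th derivative costs one more derivative.
  set m := max k (l + 1)
  have h0 := schwartzSup_nonneg m G
  refine ⟨2 ^ k * (2 ^ m * schwartzSup m G), by positivity, fun y hy ↦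
    SchwartzMap.seminorm_le_bound ℂ k l _ (by positivity) fun t ↦ ?_⟩
  have hsub : iteratedFDeriv ℝ l (⇑(trans y G - G)) t =
      iteratedFDeriv ℝ l G (t - y) - iteratedFDeriv ℝ l G t := by
    have hh : (⇑(trans y G - G)) = ⇑(trans y G) - ⇑G := by ext; simp
    rw [hh, iteratedFDeriv_sub_apply ((trans y G).smooth l).contDiffAt (G.smooth l).contDiffAt,
      iteratedFDeriv_trans]
  rw [hsub]
  have key : ‖iteratedFDeriv ℝ l G (t - y) - iteratedFDeriv ℝ l G t‖ ≤
      (2 ^ k * (2 ^ m * schwartzSup m G) * wt k t) * ‖(t - y) - t‖ := by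
    refine Convex.norm_image_sub_le_of_norm_fderiv_le (𝕜 := ℝ) (s := Metric.closedBall t 1)
      (fun x _ ↦ ?_) (fun x hx ↦ ?_) (convex_closedBall t 1) (by simp) (by simpa using hy)
    · exact ((G.smooth (l + 1 : ℕ)).differentiable_iteratedFDeriv
        (by exact_mod_cast Nat.lt_succ_self l)).differentiableAt
    · rw [norm_fderiv_iteratedFDeriv]
      have h1 := norm_iteratedFDeriv_le_wt (le_max_left k (l + 1)) (le_max_right k (l + 1)) G x
      refine h1.trans ?_
      have h2 := wt_le_pow_mul_wt_add k x (t - x)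
      rw [add_sub_cancel] at h2
      have h3 : ‖t - x‖ ≤ 1 := by rwa [← dist_eq_norm, dist_comm]
      have h4 : (1 + ‖t - x‖) ^ k ≤ 2 ^ k := by gcongr; linarith
      have h5 := wt_nonneg k t
      calc _ ≤ (2 ^ m * schwartzSup m G) * ((1 + ‖t - x‖) ^ k * wt k t) := by gcongr
        _ ≤ (2 ^ m * schwartzSup m G) * (2 ^ k * wt k t) := by gcongr
        _ = _ := by ring
  have h6 : ‖t‖ ^ k * wt k t ≤ 1 := by
    rw [← pow_mul_wt k t]
    have := wt_nonneg k t
    gcongr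
    linarith
  have h7 : ‖t - y - t‖ = ‖y‖ := by simp
  rw [h7] at key
  calc _ ≤ ‖t‖ ^ k * ((2 ^ k * (2 ^ m * schwartzSup m G) * wt k t) * ‖y‖) := by gcongr
    _ = (‖t‖ ^ k * wt k t) * (2 ^ k * (2 ^ m * schwartzSup m G) * ‖y‖) := by ring
    _ ≤ 1 * (2 ^ k * (2 ^ m * schwartzSup m G) * ‖y‖) := by gcongr
    _ = _ := by ring

lemma continuous_trans (G : 𝓢(E, ℂ)) : Continuous fun y : E ↦ trans y G := by
  have h0 : Tendsto (fun y : E ↦ trans y G) (𝓝 0) (𝓝 G) := by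
    refine ((schwartz_withSeminorms ℂ E ℂ).tendsto_nhds _ _).2 fun i ε hε ↦ ?_
    obtain ⟨C, hC0, hC⟩ := seminorm_trans_sub_le i.1 i.2 G
    have h1 : Tendsto (fun y : E ↦ C * ‖y‖) (𝓝 0) (𝓝 0) := by
      have : Continuous fun y : E ↦ C * ‖y‖ := by fun_prop
      simpa using this.tendsto 0
    filter_upwards [h1.eventually (gt_mem_nhds hε), Metric.closedBall_mem_nhds (0 : E) one_pos]
      with y hy1 hy2
    exact (hC y (by simpa using hy2)).trans_lt hy1
  -- Continuity at 0 is carried to y₀ by the group law: translating by y is translating by y - y₀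
  -- and then by y₀.
  refine continuous_iff_continuousAt.2 fun y₀ ↦ ?_
  have h1 : Tendsto (fun y ↦ y - y₀) (𝓝 y₀) (𝓝 0) := by
    have : Continuous fun y : E ↦ y - y₀ := by fun_prop
    simpa using this.tendsto y₀
  have h2 := ((compSubConstCLM ℂ y₀ : 𝓢(E, ℂ) →L[ℂ] 𝓢(E, ℂ)).continuous.tendsto G).comp
    (h0.comp h1)
  refine h2.congr fun y ↦ ?_
  ext t
  simp

/-- Joint continuity of translation. -/
lemma tendsto_trans_of_tendsto {ι : Type*} {l : Filter ι} {y : ι → E} {G : ι → 𝓢(E, ℂ)} {y₀ : E}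
    {G₀ : 𝓢(E, ℂ)} (hy : Tendsto y l (𝓝 y₀)) (hG : Tendsto G l (𝓝 G₀)) :
    Tendsto (fun i ↦ trans (y i) (G i)) l (𝓝 (trans y₀ G₀)) := by
  -- The difference G i - G₀ tends to 0 faster than the locally bounded translation constants can
  -- compensate; the rest is continuity in y for fixed G₀.
  have h1 : Tendsto (fun i ↦ trans (y i) (G i - G₀)) l (𝓝 0) := by
    refine ((schwartz_withSeminorms ℂ E ℂ).tendsto_nhds _ _).2 fun a ε hε ↦ ?_
    set m := max a.1 a.2
    have hG' : Tendsto (fun i ↦ schwartzSup m (G i - G₀)) l (𝓝 0) := by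
      have hd : Tendsto (fun i ↦ G i - G₀) l (𝓝 0) := by simpa using hG.sub_const G₀
      have h0 : schwartzSup m (0 : 𝓢(E, ℂ)) = 0 := map_zero _
      simpa [h0, Function.comp_def] using ((continuous_schwartzSup m).tendsto 0).comp hd
    have hb : Tendsto (fun i ↦ 2 ^ m * (1 + ‖y i‖) ^ m * schwartzSup m (G i - G₀)) l (𝓝 0) := by
      simpa using ((((hy.norm).const_add 1).pow m).const_mul (2 ^ m)).mul hG'
    filter_upwards [hb.eventually (gt_mem_nhds hε)] with i hi
    rw [sub_zero]
    exact ((seminorm_le_schwartzSup (le_max_left _ _) (le_max_right _ _) _).trans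
      (schwartzSup_trans_le m _ _)).trans_lt hi
  have h2 := h1.add (((continuous_trans G₀).tendsto y₀).comp hy)
  rw [zero_add] at h2
  refine h2.congr fun i ↦ ?_
  ext t
  simp

end Translation

section Product

variable {E : Type*} [NormedAddCommGroup E] [NormedSpace ℝ E]

/-- The product of two Schwartz functions. -/
abbrev smul (a b : 𝓢(E, ℂ)) : 𝓢(E, ℂ) := SchwartzMap.smulLeftCLM ℂ a b

lemma smul_apply (a b : 𝓢(E, ℂ)) (t : E) : smul a b t = a t * b t := by
  simp [smul, SchwartzMap.smulLeftCLM_apply_apply a.hasTemperateGrowth]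

/-- A translate of b is small near the origin when y is large. By Leibniz and Peetre, the decay of b
around y becomes decay in y times (1 + |t|)^N, which G absorbs at the price of N more seminorms. -/
lemma schwartzSup_trans_smul_le (b : 𝓢(E, ℂ)) (m N : ℕ) :
    ∃ C, 0 ≤ C ∧ ∀ (y : E) (G : 𝓢(E, ℂ)),
      schwartzSup m (smul (trans y b) G) ≤ C * wt N y * schwartzSup (m + N) G := by
  have hb := schwartzSup_nonneg (m + N) b
  -- The Leibniz constants are summed over all orders up to m, so that one constant serves each of
  -- them.
  refine ⟨∑ l ∈ Finset.range (m + 1), ∑ i ∈ Finset.range (l + 1), (l.choose i : ℝ) *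
    (2 ^ (m + N) * schwartzSup (m + N) b) * 2 ^ (m + N), by positivity, fun y G ↦ ?_⟩
  have hG := schwartzSup_nonneg (m + N) G
  have hw := wt_nonneg N y
  refine schwartzSup_le_of_pow (by positivity) fun l hl t ↦ ?_
  have hfun : ⇑(smul (trans y b) G) = fun t ↦ trans y b t * G t := by
    ext t; exact smul_apply _ _ _
  rw [hfun]
  have h1 := norm_iteratedFDeriv_mul_le ((trans y b).smooth l) (G.smooth l) t (n := l) le_rfl
  have hterm : ∀ i ∈ Finset.range (l + 1), (1 + ‖t‖) ^ m * ((l.choose i : ℝ) *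
      ‖iteratedFDeriv ℝ i (trans y b) t‖ * ‖iteratedFDeriv ℝ (l - i) G t‖) ≤
      (l.choose i : ℝ) * (2 ^ (m + N) * schwartzSup (m + N) b) * 2 ^ (m + N) * (wt N y *
        schwartzSup (m + N) G) := by
    intro i hi
    have hi' : i ≤ l := Nat.lt_succ_iff.1 (Finset.mem_range.1 hi)
    have h2 := norm_iteratedFDeriv_le_wt (m := m + N) (k := N) (l := i) (by omega) (by omega) b
      (t - y)
    have h3 := pow_mul_norm_iteratedFDeriv_le (m := m + N) (k := m + N) (l := l - i) le_rfl
      (by omega) G t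
    have h4 := wt_le_pow_mul_wt_add N (t - y) (-t)
    rw [show t - y + -t = -y by abel, wt_neg, norm_neg] at h4
    rw [iteratedFDeriv_trans]
    calc _ ≤ (1 + ‖t‖) ^ m * ((l.choose i : ℝ) *
          (2 ^ (m + N) * schwartzSup (m + N) b * ((1 + ‖t‖) ^ N * wt N y)) *
          ‖iteratedFDeriv ℝ (l - i) G t‖) := by
          gcongr
          exact h2.trans (by gcongr)
      _ = (l.choose i : ℝ) * (2 ^ (m + N) * schwartzSup (m + N) b) * wt N y *
          ((1 + ‖t‖) ^ (m + N) * ‖iteratedFDeriv ℝ (l - i) G t‖) := by rw [pow_add (1 + ‖t‖)]; ring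
      _ ≤ (l.choose i : ℝ) * (2 ^ (m + N) * schwartzSup (m + N) b) * wt N y *
          (2 ^ (m + N) * schwartzSup (m + N) G) := by gcongr
      _ = _ := by ring
  calc _ ≤ (1 + ‖t‖) ^ m * ∑ i ∈ Finset.range (l + 1), ((l.choose i : ℝ) *
      ‖iteratedFDeriv ℝ i (trans y b) t‖ * ‖iteratedFDeriv ℝ (l - i) G t‖) := by gcongr
    _ ≤ ∑ i ∈ Finset.range (l + 1), (l.choose i : ℝ) * (2 ^ (m + N) * schwartzSup (m + N) b) *
        2 ^ (m + N) * (wt N y * schwartzSup (m + N) G) := by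
        rw [Finset.mul_sum]
        exact Finset.sum_le_sum hterm
    _ = (∑ i ∈ Finset.range (l + 1), (l.choose i : ℝ) * (2 ^ (m + N) * schwartzSup (m + N) b) *
        2 ^ (m + N)) * (wt N y * schwartzSup (m + N) G) := by rw [Finset.sum_mul]
    _ ≤ _ := by
      rw [mul_assoc]
      gcongr
      exact Finset.single_le_sum (f := fun l ↦ ∑ i ∈ Finset.range (l + 1), (l.choose i : ℝ) *
        (2 ^ (m + N) * schwartzSup (m + N) b) * 2 ^ (m + N)) (fun _ _ ↦ by positivity)
        (Finset.mem_range.2 (by omega))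

end Product

end ModulationSpace

end

/-! ### Tempered distributions commute with integrals of Schwartz functions. -/

noncomputable section

namespace ModulationSpace

section Interchange

variable {E : Type} [NormedAddCommGroup E] [NormedSpace ℝ E] {Y : Type*} [TopologicalSpace Y]

lemma continuous_schwartz_apply {F : Type} [NormedAddCommGroup F] [NormedSpace ℝ F]
    {Φ : Y → 𝓢(E, F)} (hΦ : Continuous Φ) (t : E) : Continuous fun y ↦ Φ y t := by
  have h1 := (SchwartzMap.toBoundedContinuousFunctionCLM ℝ E F).continuous.comp hΦ
  exact (BoundedContinuousFunction.evalCLM ℝ t).continuous.comp h1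

variable [SecondCountableTopology Y] [MeasurableSpace Y] [OpensMeasurableSpace Y] {μ : Measure Y}

/-- Repeated differentiation under the integral sign, dominated by the integrable seminorms. The
target F is quantified inside the induction because each step replaces it by the space of linear
maps from E to F; for this both spaces live in the same universe. -/
lemma iteratedFDeriv_schwartz_integral (l : ℕ) : ∀ {F : Type} [NormedAddCommGroup F]
    [NormedSpace ℝ F] [CompleteSpace F] {Φ : Y → 𝓢(E, F)} (_ : Continuous Φ)
    (_ : ∀ k l, Integrable (fun y ↦ SchwartzMap.seminorm ℝ k l (Φ y)) μ) {Ψ : 𝓢(E, F)}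
    (_ : ∀ t, Ψ t = ∫ y, Φ y t ∂μ) (t : E),
    iteratedFDeriv ℝ l Ψ t = ∫ y, iteratedFDeriv ℝ l (Φ y) t ∂μ := by
  induction l with
  | zero =>
    intro F _ _ _ Φ hΦ hint Ψ h t
    simp only [iteratedFDeriv_zero_eq_comp, Function.comp_apply, h]
    exact ((continuousMultilinearCurryFin0 ℝ E F).symm.toContinuousLinearEquiv.integral_comp_comm
      (fun y ↦ Φ y t)).symm
  | succ l ih =>
    intro F _ _ _ Φ hΦ hint Ψ h t
    have hfd : ∀ t, fderivCLM ℝ E F Ψ t = ∫ y, fderivCLM ℝ E F (Φ y) t ∂μ := by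
      intro t
      have key := hasFDerivAt_integral_of_dominated_of_fderiv_le (𝕜 := ℝ) (μ := μ)
        (F := fun t y ↦ Φ y t) (F' := fun t y ↦ fderivCLM ℝ E F (Φ y) t) (x₀ := t)
        (bound := fun y ↦ SchwartzMap.seminorm ℝ 0 1 (Φ y)) (s := Set.univ) univ_mem
        (.of_forall fun t ↦ (continuous_schwartz_apply hΦ t).aestronglyMeasurable)
        (Integrable.mono' (hint 0 0) (continuous_schwartz_apply hΦ t).aestronglyMeasurable
          (.of_forall fun y ↦ SchwartzMap.norm_le_seminorm ℝ _ _))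
        (continuous_schwartz_apply ((fderivCLM ℝ E F).continuous.comp hΦ) t).aestronglyMeasurable
        (.of_forall fun y t _ ↦ ?_) (hint 0 1)
        (.of_forall fun y t _ ↦ (Φ y).hasFDerivAt t)
      · rw [← key.fderiv, fderivCLM_apply]
        congr 1
        ext t
        exact h t
      · have := SchwartzMap.norm_iteratedFDeriv_le_seminorm ℝ (Φ y) 1 t
        rwa [← norm_iteratedFDeriv_fderiv, norm_iteratedFDeriv_zero] at this
    have hint' : ∀ k l, Integrable (fun y ↦ SchwartzMap.seminorm ℝ k l (fderivCLM ℝ E F (Φ y)))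
        μ := by
      intro k l
      refine Integrable.mono' (hint k (l + 1)) ?_ (.of_forall fun y ↦ ?_)
      · exact (((schwartz_withSeminorms ℝ E (E →L[ℝ] F)).continuous_seminorm (k, l)).comp
          ((fderivCLM ℝ E F).continuous.comp hΦ)).aestronglyMeasurable
      · rw [Real.norm_of_nonneg (apply_nonneg _ _)]
        refine SchwartzMap.seminorm_le_bound ℝ k l _ (apply_nonneg _ _) fun t ↦ ?_
        have := SchwartzMap.le_seminorm ℝ k (l + 1) (Φ y) t
        rwa [← norm_iteratedFDeriv_fderiv] at this
    have h1 := ih ((fderivCLM ℝ E F).continuous.comp hΦ) hint' hfd t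
    simp only [iteratedFDeriv_succ_eq_comp_right, Function.comp_apply]
    have h2 :=
      (continuousMultilinearCurryRightEquiv' ℝ l E F).symm.toContinuousLinearEquiv.integral_comp_comm
      (μ := μ) (fun y ↦ iteratedFDeriv ℝ l (fderivCLM ℝ E F (Φ y)) t)
    refine Eq.trans ?_ h2.symm
    exact congrArg _ h1

variable (E) in
/-- Bounded continuous functions with values in the `l`-linear forms on `E`. -/
def BoundedForms (l : ℕ) : Type := BoundedContinuousFunction E (E [×l]→L[ℝ] ℂ)

instance (l : ℕ) : NormedAddCommGroup (BoundedForms E l) :=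
  inferInstanceAs (NormedAddCommGroup (BoundedContinuousFunction E (E [×l]→L[ℝ] ℂ)))

instance (l : ℕ) : NormedSpace ℂ (BoundedForms E l) :=
  inferInstanceAs (NormedSpace ℂ (BoundedContinuousFunction E (E [×l]→L[ℝ] ℂ)))

instance (l : ℕ) : CompleteSpace (BoundedForms E l) :=
  inferInstanceAs (CompleteSpace (BoundedContinuousFunction E (E [×l]→L[ℝ] ℂ)))

/-- Evaluation at a point. -/
def BoundedForms.eval (l : ℕ) (t : E) : BoundedForms E l →L[ℂ] (E [×l]→L[ℝ] ℂ) :=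
  BoundedContinuousFunction.evalCLM (β := E [×l]→L[ℝ] ℂ) ℂ t

lemma BoundedForms.ext_eval {l : ℕ} {a b : BoundedForms E l} (h : ∀ t, eval l t a = eval l t b) :
    a = b :=
  BoundedContinuousFunction.ext h

variable (E) in
/-- The weighted `l`-th derivative `t ↦ ‖t‖ᵏ Dˡ G t` of a Schwartz function as a bounded continuous
function. -/
def weightedDeriv (k l : ℕ) : 𝓢(E, ℂ) →ₗ[ℂ] BoundedForms E l where
  toFun G := BoundedContinuousFunction.ofNormedAddCommGroup
    (fun t ↦ ((‖t‖ ^ k : ℝ)) • iteratedFDeriv ℝ l G t)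
    (by
      have := (G.smooth l).continuous_iteratedFDeriv (m := l) le_rfl
      fun_prop)
    (SchwartzMap.seminorm ℂ k l G)
    (fun t ↦ by
      rw [norm_smul, norm_pow, norm_norm]
      exact SchwartzMap.le_seminorm ℂ k l G t)
  map_add' G H := by
    refine BoundedContinuousFunction.ext fun t ↦ ?_
    have hh : (⇑(G + H)) = ⇑G + ⇑H := by ext; simp
    change (‖t‖ ^ k : ℝ) • iteratedFDeriv ℝ l (⇑(G + H)) t =
      (‖t‖ ^ k : ℝ) • iteratedFDeriv ℝ l G t + (‖t‖ ^ k : ℝ) • iteratedFDeriv ℝ l H t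
    rw [hh, iteratedFDeriv_add_apply (G.smooth l).contDiffAt (H.smooth l).contDiffAt, smul_add]
  map_smul' c G := by
    refine BoundedContinuousFunction.ext fun t ↦ ?_
    have hh : (⇑(c • G)) = c • ⇑G := by ext; simp
    change (‖t‖ ^ k : ℝ) • iteratedFDeriv ℝ l (⇑(c • G)) t =
      c • ((‖t‖ ^ k : ℝ) • iteratedFDeriv ℝ l G t)
    rw [hh, iteratedFDeriv_const_smul_apply (G.smooth l).contDiffAt, smul_comm]

lemma norm_weightedDeriv (k l : ℕ) (G : 𝓢(E, ℂ)) :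
    ‖weightedDeriv E k l G‖ = SchwartzMap.seminorm ℂ k l G := by
  refine le_antisymm (BoundedContinuousFunction.norm_ofNormedAddCommGroup_le _ (apply_nonneg _ _)
    fun t ↦ by
      rw [norm_smul, norm_pow, norm_norm]
      exact SchwartzMap.le_seminorm ℂ k l G t)
    (SchwartzMap.seminorm_le_bound ℂ _ _ _ (norm_nonneg (weightedDeriv E k l G)) fun t ↦ ?_)
  have := BoundedContinuousFunction.norm_coe_le_norm (β := E [×l]→L[ℝ] ℂ) (weightedDeriv E k l G) t
  change ‖(‖t‖ ^ k : ℝ) • iteratedFDeriv ℝ l G t‖ ≤ _ at this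
  rwa [norm_smul, norm_pow, norm_norm] at this

variable (E) in
/-- The family of weighted derivatives of order at most `m`. -/
def weightedDerivs (m : ℕ) : 𝓢(E, ℂ) →ₗ[ℂ] ∀ i : Finset.Iic (m, m), BoundedForms E i.1.2 :=
  LinearMap.pi fun i ↦ weightedDeriv E i.1.1 i.1.2

lemma norm_weightedDerivs (m : ℕ) (G : 𝓢(E, ℂ)) : ‖weightedDerivs E m G‖ = schwartzSup m G := by
  refine le_antisymm ((pi_norm_le_iff_of_nonneg (schwartzSup_nonneg _ _)).2 fun i ↦ ?_)
    (schwartzSup_le (norm_nonneg _) fun k hk l hl ↦ ?_)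
  · have hi := Finset.mem_Iic.1 i.2
    exact (norm_weightedDeriv _ _ G).trans_le (seminorm_le_schwartzSup hi.1 hi.2 G)
  · have h : (k, l) ∈ Finset.Iic (m, m) := by simp [hk, hl]
    rw [← norm_weightedDeriv k l G]
    exact norm_le_pi_norm (weightedDerivs E m G) ⟨(k, l), h⟩

lemma continuous_weightedDerivs (m : ℕ) : Continuous (weightedDerivs E m) := by
  refine continuous_of_continuousAt_zero (weightedDerivs E m).toAddMonoidHom ?_
  change Tendsto (weightedDerivs E m) (𝓝 0) (𝓝 (weightedDerivs E m 0))
  rw [map_zero]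
  refine tendsto_zero_iff_norm_tendsto_zero.2 ?_
  have h := (continuous_schwartzSup (E := E) (F := ℂ) m).tendsto 0
  have h0 : schwartzSup m (0 : 𝓢(E, ℂ)) = 0 := map_zero _
  rw [h0] at h
  exact h.congr fun G ↦ (norm_weightedDerivs m G).symm

/-- A functional bounded by a norm-preserving linear image extends to the target. -/
lemma exists_strongDual_eq_comp {V X : Type*} [AddCommGroup V] [Module ℂ V] [NormedAddCommGroup X]
    [NormedSpace ℂ X] (A : V →ₗ[ℂ] X) (f : V →ₗ[ℂ] ℂ) (C : ℝ) (hf : ∀ v, ‖f v‖ ≤ C * ‖A v‖) :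
    ∃ L : StrongDual ℂ X, ∀ v, f v = L (A v) := by
  have hker : LinearMap.ker A ≤ LinearMap.ker f := by
    intro G hG
    have := hf G
    rw [LinearMap.mem_ker.1 hG, norm_zero, mul_zero] at this
    simpa using this
  let e := A.quotKerEquivRange
  let g : LinearMap.range A →ₗ[ℂ] ℂ := (Submodule.liftQ _ f hker) ∘ₗ e.symm.toLinearMap
  have hg : ∀ G, g ⟨A G, LinearMap.mem_range_self _ G⟩ = f G := by
    intro G
    have : e.symm ⟨A G, LinearMap.mem_range_self _ G⟩ = Submodule.Quotient.mk G :=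
      (LinearEquiv.symm_apply_eq _).2 rfl
    simp only [g, LinearMap.comp_apply, LinearEquiv.coe_coe, this]
    rfl
  have hbound : ∀ x, ‖g x‖ ≤ C * ‖x‖ := by
    rintro ⟨_, G, rfl⟩
    rw [hg]
    exact hf G
  -- The bound lets f factor through the range of A; Hahn–Banach extends it from there.
  obtain ⟨L, hL, -⟩ := exists_extension_norm_eq _ (g.mkContinuous C hbound)
  refine ⟨L, fun G ↦ ?_⟩
  rw [← hg G]
  exact (hL ⟨A G, LinearMap.mem_range_self _ G⟩).symm

/-- A tempered distribution commutes with integrals of continuous families of Schwartz functions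
whose seminorms are integrable. -/
theorem temperedDistribution_integral (f : 𝓢'(E, ℂ)) {Φ : Y → 𝓢(E, ℂ)} (hΦ : Continuous Φ)
    (hint : ∀ m, Integrable (fun y ↦ schwartzSup m (Φ y)) μ) {Ψ : 𝓢(E, ℂ)}
    (h : ∀ t, Ψ t = ∫ y, Φ y t ∂μ) : f Ψ = ∫ y, f (Φ y) ∂μ := by
  have hint' : ∀ k l, Integrable (fun y ↦ SchwartzMap.seminorm ℝ k l (Φ y)) μ := by
    intro k l
    refine Integrable.mono' (hint (max k l)) ?_ (.of_forall fun y ↦ ?_)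
    · exact (((schwartz_withSeminorms ℝ E ℂ).continuous_seminorm (k, l)).comp
        hΦ).aestronglyMeasurable
    · rw [Real.norm_of_nonneg (apply_nonneg _ _)]
      exact seminorm_le_schwartzSup (le_max_left k l) (le_max_right k l) (Φ y)
  -- Having finite order, f factors through the normed space of weighted derivatives up to order m.
  -- There it is a bounded functional on a Banach space and commutes with the Bochner integral,
  -- which is computed by point evaluations.
  obtain ⟨m, C, hC, hf⟩ := exists_norm_le_schwartzSup f
  obtain ⟨L, hL⟩ := exists_strongDual_eq_comp (weightedDerivs E m) f.toLinearMap C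
    fun G ↦ (hf G).trans_eq (by rw [norm_weightedDerivs])
  replace hL : ∀ G, f G = L (weightedDerivs E m G) := hL
  have hι : Integrable (fun y ↦ weightedDerivs E m (Φ y)) μ :=
    Integrable.mono' (hint m) ((continuous_weightedDerivs m).comp hΦ).aestronglyMeasurable
      (.of_forall fun y ↦ (norm_weightedDerivs m _).le)
  have hΨ : weightedDerivs E m Ψ = ∫ y, weightedDerivs E m (Φ y) ∂μ := by
    funext i
    refine BoundedForms.ext_eval fun t ↦ ?_
    have hi : ∀ i, Integrable (fun y ↦ weightedDerivs E m (Φ y) i) μ := fun i ↦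
      Integrable.mono' (hint m) ((continuous_apply i).comp
        ((continuous_weightedDerivs m).comp hΦ)).aestronglyMeasurable
        (.of_forall fun y ↦ (norm_le_pi_norm _ i).trans (norm_weightedDerivs m _).le)
    rw [eval_integral hi, ← ContinuousLinearMap.integral_comp_comm _ (hi i)]
    change (‖t‖ ^ i.1.1 : ℝ) • iteratedFDeriv ℝ i.1.2 Ψ t =
      ∫ y, (‖t‖ ^ i.1.1 : ℝ) • iteratedFDeriv ℝ i.1.2 (Φ y) t ∂μ
    rw [integral_smul, iteratedFDeriv_schwartz_integral i.1.2 hΦ hint' h t]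
  rw [hL, hΨ, ← ContinuousLinearMap.integral_comp_comm L hι]
  simp only [hL]

end Interchange

end ModulationSpace

end

/-! ### Time-frequency shifts, atoms and their decay. -/

noncomputable section

namespace ModulationSpace

variable {n : ℕ}

/-- `t ↦ e^{i t·ζ}`. -/
def wave (ζ t : Rn n) : ℂ := Complex.exp (Complex.I * ((inner ℝ t ζ : ℝ) : ℂ))

lemma norm_wave (ζ t : Rn n) : ‖wave ζ t‖ = 1 := by
  rw [wave, mul_comm]
  exact Complex.norm_exp_ofReal_mul_I _

lemma wave_add_left (ζ ζ' t : Rn n) : wave (ζ + ζ') t = wave ζ t * wave ζ' t := by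
  simp [wave, ← Complex.exp_add, inner_add_right, mul_add]

lemma wave_add_right (ζ t t' : Rn n) : wave ζ (t + t') = wave ζ t * wave ζ t' := by
  simp [wave, ← Complex.exp_add, inner_add_left, mul_add]

@[fun_prop]
lemma continuous_wave : Continuous fun p : Rn n × Rn n ↦ wave p.1 p.2 := by
  unfold wave
  fun_prop

lemma exp_neg_I_mul_inner (ζ t : Rn n) :
    Complex.exp (-Complex.I * ((inner ℝ t ζ : ℝ) : ℂ)) = wave (-ζ) t := by
  simp [wave, inner_neg_right]

lemma fourier_trans (a : Rn n) (H : 𝓢(Rn n, ℂ)) (w : Rn n) :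
    𝓕 (trans a H) w = wave (-((2 * Real.pi) • w)) a * 𝓕 H w := by
  rw [fourier_coe, fourier_coe, Real.fourier_eq', Real.fourier_eq', ← integral_const_mul,
    ← integral_sub_right_eq_self (fun v ↦ wave (-((2 * Real.pi) • w)) a * _) a]
  refine integral_congr_ae (.of_forall fun v ↦ ?_)
  simp only [compSubConstCLM_apply, smul_eq_mul, ← mul_assoc, wave, ← Complex.exp_add]
  congr 2
  simp only [inner_sub_left, inner_neg_right, inner_smul_right]
  push_cast
  ring

lemma fourier_trans_fourierInv (ξ : Rn n) (G : 𝓢(Rn n, ℂ)) (t : Rn n) :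
    𝓕 (trans ((2 * Real.pi)⁻¹ • ξ) (𝓕⁻ G)) t = wave (-ξ) t * G t := by
  rw [fourier_trans, fourier_fourierInv_eq]
  congr 1
  have : (2 * Real.pi) * (2 * Real.pi)⁻¹ = 1 := mul_inv_cancel₀ (by positivity)
  simp only [wave, inner_neg_right, inner_smul_right, inner_smul_left, real_inner_comm ξ t]
  congr 3
  simp only [conj_trivial]
  rw [← mul_assoc, this, one_mul]

/-- The complex conjugate of a Schwartz function. -/
abbrev conjS (φ : 𝓢(Rn n, ℂ)) : 𝓢(Rn n, ℂ) := φ.postcompCLM (Complex.conjCLE : ℂ →L[ℝ] ℂ)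

/-- Modulation is translation on the Fourier side. Continuity in (x, ξ) and polynomial seminorm
bounds thus reduce to those of translations and to continuity of the Fourier transform. -/
lemma timeFreqShift_eq_fourier (φ : 𝓢(Rn n, ℂ)) (x ξ : Rn n) :
    timeFreqShift φ x ξ = 𝓕 (trans ((2 * Real.pi)⁻¹ • ξ) (𝓕⁻ (trans x (conjS φ)))) := by
  ext t
  rw [fourier_trans_fourierInv, timeFreqShift_apply, exp_neg_I_mul_inner, mul_comm]
  rfl

lemma timeFreqShift_apply_wave (φ : 𝓢(Rn n, ℂ)) (x ξ t : Rn n) :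
    timeFreqShift φ x ξ t = conjS φ (t - x) * wave (-ξ) t := by
  rw [timeFreqShift_apply, exp_neg_I_mul_inner]
  rfl

lemma continuous_timeFreqShift (φ : 𝓢(Rn n, ℂ)) :
    Continuous fun z : Rn n × Rn n ↦ timeFreqShift φ z.1 z.2 := by
  simp_rw [timeFreqShift_eq_fourier]
  refine (fourierCLM ℂ 𝓢(Rn n, ℂ)).continuous.comp (continuous_iff_continuousAt.2 fun z ↦ ?_)
  refine tendsto_trans_of_tendsto (Continuous.tendsto (by fun_prop) z) (Continuous.tendsto
    (f := fun z : Rn n × Rn n ↦ 𝓕⁻ (trans z.1 (conjS φ))) ?_ z)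
  exact (fourierInvCLM ℂ 𝓢(Rn n, ℂ)).continuous.comp ((continuous_trans _).comp continuous_fst)

lemma continuous_stft (φ : 𝓢(Rn n, ℂ)) (f : 𝓢'(Rn n, ℂ)) :
    Continuous fun z : Rn n × Rn n ↦ stft φ f z.1 z.2 :=
  continuous_const.mul (f.continuous.comp (continuous_timeFreqShift φ))

lemma norm_two_pi_inv_smul_le (ξ : Rn n) : ‖(2 * Real.pi)⁻¹ • ξ‖ ≤ ‖ξ‖ := by
  rw [norm_smul, Real.norm_of_nonneg (by positivity)]
  refine mul_le_of_le_one_left (norm_nonneg _) (inv_le_one_of_one_le₀ ?_)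
  nlinarith [Real.pi_gt_three]

lemma schwartzSup_timeFreqShift_le (φ : 𝓢(Rn n, ℂ)) (m : ℕ) : ∃ (M : ℕ) (C : ℝ), 0 ≤ C ∧
    ∀ z : Rn n × Rn n, schwartzSup m (timeFreqShift φ z.1 z.2) ≤
      C * ((1 + ‖z.1‖) ^ M * (1 + ‖z.2‖) ^ M) := by
  obtain ⟨m₁, C₁, hC₁, h₁⟩ := exists_schwartzSup_le (fourierCLM ℂ 𝓢(Rn n, ℂ)) m
  obtain ⟨m₂, C₂, hC₂, h₂⟩ := exists_schwartzSup_le (fourierInvCLM ℂ 𝓢(Rn n, ℂ)) m₁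
  have h0 := schwartzSup_nonneg m₂ (conjS φ)
  refine ⟨max m₁ m₂, C₁ * (2 ^ m₁ * (C₂ * (2 ^ m₂ * schwartzSup m₂ (conjS φ)))), by positivity,
    fun z ↦ ?_⟩
  rw [timeFreqShift_eq_fourier]
  have hz1 : 1 ≤ 1 + ‖z.1‖ := by linarith [norm_nonneg z.1]
  have hz2 : 1 ≤ 1 + ‖z.2‖ := by linarith [norm_nonneg z.2]
  calc _ ≤ C₁ * schwartzSup m₁ (trans ((2 * Real.pi)⁻¹ • z.2) (𝓕⁻ (trans z.1 (conjS φ)))) := h₁ _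
    _ ≤ C₁ * (2 ^ m₁ * (1 + ‖(2 * Real.pi)⁻¹ • z.2‖) ^ m₁ *
        schwartzSup m₁ (𝓕⁻ (trans z.1 (conjS φ)))) := by
        gcongr; exact schwartzSup_trans_le _ _ _
    _ ≤ C₁ * (2 ^ m₁ * (1 + ‖z.2‖) ^ (max m₁ m₂) *
        (C₂ * (2 ^ m₂ * (1 + ‖z.1‖) ^ (max m₁ m₂) * schwartzSup m₂ (conjS φ)))) := by
        gcongr
        · exact schwartzSup_nonneg _ _
        · refine (pow_le_pow_left₀ (by positivity)
            (add_le_add_right (norm_two_pi_inv_smul_le z.2) 1) _).trans ?_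
          exact pow_le_pow_right₀ hz2 (le_max_left _ _)
        · refine (h₂ _).trans ?_
          gcongr
          refine (schwartzSup_trans_le _ _ _).trans ?_
          gcongr
          exact le_max_right _ _
    _ = _ := by ring

lemma norm_stft_le (φ : 𝓢(Rn n, ℂ)) (f : 𝓢'(Rn n, ℂ)) : ∃ (M : ℕ) (C : ℝ), 0 ≤ C ∧
    ∀ z : Rn n × Rn n, ‖stft φ f z.1 z.2‖ ≤ C * ((1 + ‖z.1‖) ^ M * (1 + ‖z.2‖) ^ M) := by
  obtain ⟨m, C, hC, hf⟩ := exists_norm_le_schwartzSup f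
  obtain ⟨M, C', hC', h⟩ := schwartzSup_timeFreqShift_le φ m
  refine ⟨M, (2 * Real.pi) ^ (-(n : ℝ) / 2) * (C * C'), by positivity, fun z ↦ ?_⟩
  rw [stft, norm_mul, Complex.norm_real, Real.norm_of_nonneg (by positivity), mul_assoc, mul_assoc]
  gcongr
  exact (hf _).trans (mul_le_mul_of_nonneg_left (h z) hC)

lemma integral_mul_wave (G : 𝓢(Rn n, ℂ)) (ζ : Rn n) :
    ∫ t, G t * wave ζ t = 𝓕⁻ G ((2 * Real.pi)⁻¹ • ζ) := by
  rw [fourierInv_coe, Real.fourierInv_eq']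
  refine integral_congr_ae (.of_forall fun t ↦ ?_)
  simp only [wave, smul_eq_mul, inner_smul_right]
  rw [mul_comm, ← mul_assoc, mul_inv_cancel₀ (by positivity : 2 * Real.pi ≠ 0), one_mul,
    mul_comm Complex.I]

/-- The integral is an inverse Fourier transform at ζ/(2π), so it decays rapidly, with constants
controlled by continuity of that transform on the Schwartz space. -/
lemma exists_norm_integral_mul_wave_le (N : ℕ) : ∃ (m : ℕ) (C : ℝ), 0 ≤ C ∧
    ∀ (G : 𝓢(Rn n, ℂ)) (ζ : Rn n), ‖∫ t, G t * wave ζ t‖ ≤ C * wt N ζ * schwartzSup m G := by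
  obtain ⟨m, C, hC, h⟩ := exists_schwartzSup_le (fourierInvCLM ℂ 𝓢(Rn n, ℂ)) N
  refine ⟨m, 2 ^ N * C * (2 * Real.pi) ^ N, by positivity, fun G ζ ↦ ?_⟩
  rw [integral_mul_wave]
  -- Undoes the rescaling: 1 + |ζ| ≤ 2π (1 + |ζ|/(2π)) because 2π ≥ 1.
  have hw : wt N ((2 * Real.pi)⁻¹ • ζ) ≤ (2 * Real.pi) ^ N * wt N ζ := by
    rw [le_mul_wt_iff]
    unfold wt
    rw [← div_eq_mul_inv, ← div_pow]
    gcongr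
    rw [div_le_iff₀ (by positivity), norm_smul, Real.norm_of_nonneg (by positivity), mul_add,
      ← mul_assoc, mul_inv_cancel₀ (by positivity : 2 * Real.pi ≠ 0)]
    nlinarith [Real.pi_gt_three]
  have h0 := schwartzSup_nonneg m G
  calc _ ≤ 2 ^ N * schwartzSup N (𝓕⁻ G) * wt N ((2 * Real.pi)⁻¹ • ζ) := norm_le_wt _ _ _
    _ ≤ 2 ^ N * (C * schwartzSup m G) * ((2 * Real.pi) ^ N * wt N ζ) := by
      gcongr
      · exact wt_nonneg _ _
      · exact h G
    _ = _ := by ring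

/-- The time-frequency atom `t ↦ φ (t - y) e^{i t·η}`, `z = (y, η)`. -/
def atom (φ : 𝓢(Rn n, ℂ)) (z : Rn n × Rn n) (t : Rn n) : ℂ := φ (t - z.1) * wave z.2 t

lemma continuous_atom (φ : 𝓢(Rn n, ℂ)) :
    Continuous fun p : (Rn n × Rn n) × Rn n ↦ atom φ p.1 p.2 := by
  unfold atom
  have := φ.continuous
  have h : Continuous fun p : (Rn n × Rn n) × Rn n ↦ wave p.1.2 p.2 :=
    continuous_wave.comp (f := fun p : (Rn n × Rn n) × Rn n ↦ (p.1.2, p.2)) (by fun_prop)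
  fun_prop

lemma norm_atom (φ : 𝓢(Rn n, ℂ)) (z : Rn n × Rn n) (t : Rn n) : ‖atom φ z t‖ = ‖φ (t - z.1)‖ := by
  rw [atom, norm_mul, norm_wave, mul_one]

/-- The pairing of a Schwartz function with an atom. -/
def pairAtom (φ : 𝓢(Rn n, ℂ)) (z : Rn n × Rn n) (G : 𝓢(Rn n, ℂ)) : ℂ := ∫ t, atom φ z t * G t

lemma pairAtom_eq (φ : 𝓢(Rn n, ℂ)) (z : Rn n × Rn n) (G : 𝓢(Rn n, ℂ)) :
    pairAtom φ z G = ∫ t, smul (trans z.1 φ) G t * wave z.2 t := by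
  refine integral_congr_ae (.of_forall fun t ↦ ?_)
  simp only [atom, smul_apply, compSubConstCLM_apply]
  ring

/-- Decay in frequency comes from the Fourier integral, decay in position from the product of G with
a translated window. -/
lemma exists_norm_pairAtom_le (φ : 𝓢(Rn n, ℂ)) (N : ℕ) : ∃ (m : ℕ) (C : ℝ), 0 ≤ C ∧
    ∀ (z : Rn n × Rn n) (G : 𝓢(Rn n, ℂ)),
      ‖pairAtom φ z G‖ ≤ C * (wt N z.1 * wt N z.2) * schwartzSup m G := by
  obtain ⟨m, C, hC, h⟩ := exists_norm_integral_mul_wave_le (n := n) N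
  obtain ⟨C', hC', h'⟩ := schwartzSup_trans_smul_le φ m N
  refine ⟨m + N, C * C', by positivity, fun z G ↦ ?_⟩
  rw [pairAtom_eq]
  have hw := wt_nonneg N z.2
  calc _ ≤ C * wt N z.2 * schwartzSup m (smul (trans z.1 φ) G) := h _ _
    _ ≤ C * wt N z.2 * (C' * wt N z.1 * schwartzSup (m + N) G) := by gcongr; exact h' _ _
    _ = _ := by ring

lemma integral_trans_mul_trans (a b : 𝓢(Rn n, ℂ)) (y y' ζ : Rn n) (G : 𝓢(Rn n, ℂ)) :
    ∫ t, a (t - y) * b (t - y') * wave ζ t * G t = pairAtom a (y, ζ) (smul (trans y' b) G) := by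
  rw [pairAtom]
  congr 1 with t
  rw [atom, smul_apply, compSubConstCLM_apply]
  ring

/-- Decay of the Fourier transform of the product of two translated Schwartz functions and a third
one. -/
lemma exists_norm_integral_trans_mul_trans_le (a b : 𝓢(Rn n, ℂ)) (N : ℕ) : ∃ (m : ℕ) (C : ℝ),
    0 ≤ C ∧ ∀ (y y' ζ : Rn n) (G : 𝓢(Rn n, ℂ)),
      ‖∫ t, a (t - y) * b (t - y') * wave ζ t * G t‖ ≤
        C * (wt N y * wt N y' * wt N ζ) * schwartzSup m G := by
  obtain ⟨m, C, hC, h⟩ := exists_norm_pairAtom_le a N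
  obtain ⟨C', hC', h'⟩ := schwartzSup_trans_smul_le b m N
  refine ⟨m + N, C * C', mul_nonneg hC hC', fun y y' ζ G ↦ ?_⟩
  rw [integral_trans_mul_trans]
  have hw := wt_nonneg N y
  have hw' := wt_nonneg N ζ
  refine (h _ _).trans ?_
  refine (mul_le_mul_of_nonneg_left (h' y' G) (by positivity)).trans_eq ?_
  ring

lemma continuous_pairAtom (φ G : 𝓢(Rn n, ℂ)) : Continuous fun z ↦ pairAtom φ z G := by
  refine continuous_of_dominated (bound := fun t ↦ SchwartzMap.seminorm ℝ 0 0 φ * ‖G t‖)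
    (fun z ↦ ?_) (fun z ↦ .of_forall fun t ↦ ?_) (G.integrable.norm.const_mul _)
    (.of_forall fun t ↦ ?_)
  · have h := (continuous_atom φ).comp (Continuous.prodMk_right z)
    exact (h.mul G.continuous).aestronglyMeasurable
  · rw [norm_mul, norm_atom]
    gcongr
    exact SchwartzMap.norm_le_seminorm ℝ _ _
  · exact ((continuous_atom φ).comp (Continuous.prodMk_left t)).mul continuous_const

lemma integrable_wt {N : ℕ} (hN : n < N) : Integrable (wt N : Rn n → ℝ) := by
  have h := integrable_one_add_norm (E := Rn n) (μ := volume) (r := N) (by simpa using hN)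
  refine h.congr (.of_forall fun x ↦ ?_)
  simp only [wt]
  rw [Real.rpow_neg (by positivity), Real.rpow_natCast]

lemma integrable_wt_mul_wt {N : ℕ} (hN : n < N) :
    Integrable fun z : Rn n × Rn n ↦ wt N z.1 * wt N z.2 :=
  (integrable_wt hN).mul_prod (integrable_wt hN)

end ModulationSpace

end

/-! ### Inversion of the short-time Fourier transform. -/

noncomputable section

namespace ModulationSpace

variable {n : ℕ}

section Inversion

/-- As a function of η the pairing is a dilated inverse Fourier transform of φ(· - y) G, so this is
Fourier inversion; the factor (2π)^n is the Jacobian of the dilation. -/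
lemma integral_pairAtom_mul_wave (φ G : 𝓢(Rn n, ℂ)) (y t : Rn n) :
    ∫ η, pairAtom φ (y, η) G * wave (-η) t = (2 * Real.pi) ^ n * (φ (t - y) * G t) := by
  have h1 : ∀ η, pairAtom φ (y, η) G * wave (-η) t =
      (fun w ↦ 𝓕⁻ (smul (trans y φ) G) w * wave (-((2 * Real.pi) • w)) t)
        ((2 * Real.pi)⁻¹ • η) := by
    intro η
    simp only [pairAtom_eq, integral_mul_wave]
    rw [smul_smul, mul_inv_cancel₀ (by positivity : 2 * Real.pi ≠ 0), one_smul]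
  simp_rw [h1]
  rw [Measure.integral_comp_inv_smul volume
    (fun w ↦ 𝓕⁻ (smul (trans y φ) G) w * wave (-((2 * Real.pi) • w)) t)]
  have h2 : ∫ w, 𝓕⁻ (smul (trans y φ) G) w * wave (-((2 * Real.pi) • w)) t =
      𝓕 (𝓕⁻ (smul (trans y φ) G)) t := by
    rw [fourier_coe, Real.fourier_eq']
    refine integral_congr_ae (.of_forall fun w ↦ ?_)
    simp only [wave, smul_eq_mul, inner_neg_right, inner_smul_right, real_inner_comm]
    rw [mul_comm]
    congr 2
    push_cast
    ring
  rw [h2, fourier_fourierInv_eq, smul_apply, compSubConstCLM_apply, finrank_euclideanSpace,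
    Fintype.card_fin, abs_of_nonneg (by positivity), Complex.real_smul]
  push_cast
  rfl

lemma integrable_pairAtom (φ G : 𝓢(Rn n, ℂ)) (M : ℕ) :
    Integrable fun z : Rn n × Rn n ↦ ((1 + ‖z.1‖) ^ M * (1 + ‖z.2‖) ^ M) * ‖pairAtom φ z G‖ := by
  -- M powers absorb the polynomial factor and n + 1 leave an integrable weight. The same splitting
  -- of exponents recurs below.
  obtain ⟨m, C, hC, h⟩ := exists_norm_pairAtom_le φ (M + (n + 1))
  refine Integrable.mono' ((integrable_wt_mul_wt (Nat.lt_succ_self n)).const_mul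
    (C * schwartzSup m G)) ?_ (.of_forall fun z ↦ ?_)
  · have := continuous_pairAtom φ G
    exact Continuous.aestronglyMeasurable (by fun_prop)
  · rw [Real.norm_of_nonneg (by positivity)]
    calc _ ≤ ((1 + ‖z.1‖) ^ M * (1 + ‖z.2‖) ^ M) *
          (C * (wt (M + (n + 1)) z.1 * wt (M + (n + 1)) z.2) * schwartzSup m G) := by
          gcongr; exact h z G
      _ = C * schwartzSup m G * (((1 + ‖z.1‖) ^ M * wt (M + (n + 1)) z.1) *
          ((1 + ‖z.2‖) ^ M * wt (M + (n + 1)) z.2)) := by ring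
      _ = _ := by rw [pow_mul_wt_add, pow_mul_wt_add]

/-- Inversion for Schwartz functions: the η-integral leaves (2π)^n |φ(t - y)|² G(t), and the
y-integral then produces the squared L² norm of φ. -/
lemma integral_pairAtom_mul_timeFreqShift (φ G : 𝓢(Rn n, ℂ)) (t : Rn n) :
    ∫ z : Rn n × Rn n, pairAtom φ z G * timeFreqShift φ z.1 z.2 t =
      ((2 * Real.pi) ^ n * ((∫ y, ‖φ y‖ ^ 2 : ℝ) : ℂ)) * G t := by
  have hint : Integrable (fun z : Rn n × Rn n ↦ pairAtom φ z G * timeFreqShift φ z.1 z.2 t) := by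
    refine Integrable.mono' ((integrable_pairAtom φ G 0).const_mul (SchwartzMap.seminorm ℝ 0 0 φ))
      ?_ (.of_forall fun z ↦ ?_)
    · have := continuous_pairAtom φ G
      have := continuous_schwartz_apply (continuous_timeFreqShift φ) t
      exact Continuous.aestronglyMeasurable (by fun_prop)
    · rw [norm_mul, timeFreqShift_apply_wave, norm_mul, norm_wave, mul_one, mul_comm, pow_zero,
        pow_zero, one_mul, one_mul]
      gcongr
      have : ‖conjS φ (t - z.1)‖ = ‖φ (t - z.1)‖ := by simp
      rw [this]
      exact SchwartzMap.norm_le_seminorm ℝ _ _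
  rw [Measure.volume_eq_prod, integral_prod _ hint]
  have h1 : ∀ y, ∫ η, pairAtom φ (y, η) G * timeFreqShift φ y η t =
      ((2 * Real.pi) ^ n * G t) * ((‖φ (t - y)‖ ^ 2 : ℝ) : ℂ) := by
    intro y
    simp_rw [timeFreqShift_apply_wave]
    have h2 : ∀ η, pairAtom φ (y, η) G * (conjS φ (t - y) * wave (-η) t) =
        conjS φ (t - y) * (pairAtom φ (y, η) G * wave (-η) t) := fun η ↦ by ring
    simp_rw [h2]
    rw [integral_const_mul, integral_pairAtom_mul_wave]
    have h3 : conjS φ (t - y) * φ (t - y) = ((‖φ (t - y)‖ ^ 2 : ℝ) : ℂ) := by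
      have := Complex.conj_mul' (φ (t - y))
      push_cast
      rw [← this]
      rfl
    rw [← h3]
    ring
  simp_rw [h1]
  rw [integral_const_mul, integral_complex_ofReal,
    integral_sub_left_eq_self (fun y ↦ ‖φ y‖ ^ 2) volume t]
  ring

lemma integral_norm_sq_pos {φ : 𝓢(Rn n, ℂ)} (hφ : φ ≠ 0) : 0 < ∫ y, ‖φ y‖ ^ 2 := by
  have hint : Integrable fun y ↦ ‖φ y‖ ^ 2 := by
    have := (φ.memLp 2).integrable_norm_pow (by norm_num)
    simpa using this
  refine lt_of_le_of_ne (integral_nonneg fun y ↦ by positivity) fun h ↦ hφ ?_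
  have h1 := (integral_eq_zero_iff_of_nonneg (fun y ↦ by positivity) hint).1 h.symm
  have h2 := Continuous.ae_eq_iff_eq volume (f := fun y ↦ ‖φ y‖ ^ 2) (g := 0)
    (by have := φ.continuous; fun_prop) continuous_const
  have h3 := h2.1 h1
  ext y
  simpa using congrFun h3 y

/-- Inversion formula for the short-time Fourier transform of tempered distributions. -/
theorem exists_stft_inversion {φ : 𝓢(Rn n, ℂ)} (hφ : φ ≠ 0) : ∃ c : ℂ, ∀ (f : 𝓢'(Rn n, ℂ))
    (G : 𝓢(Rn n, ℂ)), f G = c * ∫ z : Rn n × Rn n, stft φ f z.1 z.2 * pairAtom φ z G := by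
  set c₀ : ℂ := (2 * Real.pi) ^ n * ((∫ y, ‖φ y‖ ^ 2 : ℝ) : ℂ) with hc₀
  have hc : c₀ ≠ 0 := by
    refine mul_ne_zero (pow_ne_zero _ ?_) (by exact_mod_cast (integral_norm_sq_pos hφ).ne')
    exact_mod_cast (by positivity : (2 * Real.pi) ≠ 0)
  set c₁ : ℂ := (((2 * Real.pi) ^ (-(n : ℝ) / 2) : ℝ) : ℂ) with hc₁
  have hc1 : c₁ ≠ 0 := by
    rw [hc₁]
    exact_mod_cast (by positivity : (2 * Real.pi) ^ (-(n : ℝ) / 2) ≠ 0)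
  refine ⟨c₀⁻¹ * c₁⁻¹, fun f G ↦ ?_⟩
  -- Apply f to the inversion formula for G. Taking f inside is legitimate because rapid decay of
  -- `pairAtom` beats polynomial growth of the seminorms of the shifts.
  have key := temperedDistribution_integral (μ := (volume : Measure (Rn n × Rn n))) f
    (Φ := fun z ↦ pairAtom φ z G • timeFreqShift φ z.1 z.2) (Ψ := c₀ • G)
    ((continuous_pairAtom φ G).smul (continuous_timeFreqShift φ)) (fun m ↦ ?_) (fun t ↦ ?_)
  · have h1 : ∀ z : Rn n × Rn n, f (pairAtom φ z G • timeFreqShift φ z.1 z.2) =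
        c₁⁻¹ * (stft φ f z.1 z.2 * pairAtom φ z G) := by
      intro z
      rw [map_smul, stft, ← hc₁, smul_eq_mul]
      field_simp
    simp_rw [h1] at key
    rw [integral_const_mul, map_smul, smul_eq_mul] at key
    rw [mul_assoc, ← key, ← mul_assoc, inv_mul_cancel₀ hc, one_mul]
  · obtain ⟨M, C, hC, h⟩ := schwartzSup_timeFreqShift_le φ m
    refine Integrable.mono' ((integrable_pairAtom φ G M).const_mul C) ?_ (.of_forall fun z ↦ ?_)
    · exact ((continuous_schwartzSup m).comp
        ((continuous_pairAtom φ G).smul (continuous_timeFreqShift φ))).aestronglyMeasurable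
    · rw [Real.norm_of_nonneg (schwartzSup_nonneg _ _)]
      have h2 : schwartzSup m (pairAtom φ z G • timeFreqShift φ z.1 z.2) =
          ‖pairAtom φ z G‖ * schwartzSup m (timeFreqShift φ z.1 z.2) := map_smul_eq_mul _ _ _
      rw [h2]
      calc _ ≤ ‖pairAtom φ z G‖ * (C * ((1 + ‖z.1‖) ^ M * (1 + ‖z.2‖) ^ M)) := by
            gcongr; exact h z
        _ = _ := by ring
  · have h3 := integral_pairAtom_mul_timeFreqShift φ G t
    simpa using h3.symm

end Inversion

/-! ### Fourier multipliers as smooth functions of temperate growth. -/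

section Convolution

/-- The function `t ↦ f (κ (· - t))`. -/
def corr (f : 𝓢'(Rn n, ℂ)) (κ : 𝓢(Rn n, ℂ)) (t : Rn n) : ℂ := f (trans t κ)

lemma continuous_corr (f : 𝓢'(Rn n, ℂ)) (κ : 𝓢(Rn n, ℂ)) : Continuous (corr f κ) :=
  f.continuous.comp (continuous_trans κ)

lemma exists_norm_corr_le (f : 𝓢'(Rn n, ℂ)) (κ : 𝓢(Rn n, ℂ)) : ∃ (k : ℕ) (C : ℝ), 0 ≤ C ∧
    ∀ t, ‖corr f κ t‖ ≤ C * (1 + ‖t‖) ^ k := by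
  obtain ⟨m, C, hC, h⟩ := exists_norm_le_schwartzSup f
  have h0 := schwartzSup_nonneg m κ
  refine ⟨m, C * (2 ^ m * schwartzSup m κ), by positivity, fun t ↦ (h _).trans ?_⟩
  calc _ ≤ C * (2 ^ m * (1 + ‖t‖) ^ m * schwartzSup m κ) := by
        gcongr; exact schwartzSup_trans_le _ _ _
    _ = _ := by ring

/-- The convolution theorem: multiplying by g on the Fourier side convolves Φ with the Fourier
transform of g. -/
lemma fourier_smul_fourierInv (g Φ : 𝓢(Rn n, ℂ)) (t : Rn n) :
    𝓕 (smul g (𝓕⁻ Φ)) t = ∫ r, Φ r * 𝓕 g (t - r) := by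
  set ξ : Rn n := (2 * Real.pi) • t
  have hξ : (2 * Real.pi)⁻¹ • ξ = t := by
    rw [smul_smul, inv_mul_cancel₀ (by positivity), one_smul]
  have h1 : 𝓕 (smul g (𝓕⁻ Φ)) t = ∫ w, 𝓕 (trans t (𝓕⁻ g)) w * 𝓕⁻ Φ w := by
    rw [fourier_coe, Real.fourier_eq']
    refine integral_congr_ae (.of_forall fun w ↦ ?_)
    simp only
    have h2 := fourier_trans_fourierInv ξ g w
    rw [hξ] at h2
    rw [h2, smul_apply, smul_eq_mul, ← mul_assoc]
    congr 2
    simp only [wave, ξ, inner_neg_right, inner_smul_right]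
    congr 1
    push_cast
    ring
  rw [h1, ← SchwartzMap.integral_fourierInv_mul_eq, fourierInv_fourier_eq]
  refine integral_congr_ae (.of_forall fun r ↦ ?_)
  simp only [compSubConstCLM_apply]
  rw [mul_comm, fourierInv_coe, fourier_coe, Real.fourierInv_eq_fourier_neg, neg_sub]

/-- The left side is the multiplier with symbol g applied to f and tested on Φ; taking f inside the
convolution integral exhibits it as the function `corr f (𝓕 g)`. -/
lemma integral_mul_corr (f : 𝓢'(Rn n, ℂ)) (g Φ : 𝓢(Rn n, ℂ)) :
    f (𝓕 (smul g (𝓕⁻ Φ))) = ∫ t, Φ t * corr f (𝓕 g) t := by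
  have hcont : Continuous fun r ↦ Φ r • trans r (𝓕 g) := Φ.continuous.smul (continuous_trans _)
  have key := temperedDistribution_integral (μ := (volume : Measure (Rn n))) f hcont
    (fun m ↦ ?_) (fun t ↦ by simpa using fourier_smul_fourierInv g Φ t)
  · rw [key]
    refine integral_congr_ae (.of_forall fun r ↦ ?_)
    simp [corr]
  · have h0 := schwartzSup_nonneg m (𝓕 g)
    refine Integrable.mono' ((integrable_wt (Nat.lt_succ_self n)).const_mul
      (2 ^ (m + (n + 1)) * schwartzSup (m + (n + 1)) Φ * (2 ^ m * schwartzSup m (𝓕 g))))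
      ((continuous_schwartzSup m).comp hcont).aestronglyMeasurable (.of_forall fun r ↦ ?_)
    rw [Real.norm_of_nonneg (schwartzSup_nonneg _ _)]
    have h2 : schwartzSup m (Φ r • trans r (𝓕 g)) = ‖Φ r‖ * schwartzSup m (trans r (𝓕 g)) :=
      map_smul_eq_mul _ _ _
    rw [h2]
    calc _ ≤ (2 ^ (m + (n + 1)) * schwartzSup (m + (n + 1)) Φ * wt (m + (n + 1)) r) *
          (2 ^ m * (1 + ‖r‖) ^ m * schwartzSup m (𝓕 g)) := by
          refine mul_le_mul (norm_le_wt _ _ _) (schwartzSup_trans_le _ _ _)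
            (schwartzSup_nonneg _ _) ((norm_nonneg (Φ r)).trans (norm_le_wt _ _ _))
      _ = 2 ^ (m + (n + 1)) * schwartzSup (m + (n + 1)) Φ * (2 ^ m * schwartzSup m (𝓕 g)) *
          ((1 + ‖r‖) ^ m * wt (m + (n + 1)) r) := by ring
      _ = _ := by rw [pow_mul_wt_add]

section Smoothness

open LineDeriv

lemma trans_sub_trans_apply (κ : 𝓢(Rn n, ℂ)) (t v x : Rn n) :
    (trans t κ - trans (t + v) κ) x =
      ∫ s in Set.Icc (0 : ℝ) 1, trans (t + s • v) (∂_{v} κ) x := by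
  have hd : ∀ s : ℝ, HasDerivAt (fun s : ℝ ↦ κ (x - t - s • v))
      (-(trans (t + s • v) (∂_{v} κ) x)) s := by
    intro s
    have h1 : HasDerivAt (fun s : ℝ ↦ x - t - s • v) (-v) s := by
      simpa using ((hasDerivAt_id s).smul_const v).const_sub (x - t)
    have h2 := (κ.hasFDerivAt (x - t - s • v)).comp_hasDerivAt s h1
    have h3 : -(trans (t + s • v) (∂_{v} κ) x) = fderiv ℝ κ (x - t - s • v) (-v) := by
      rw [compSubConstCLM_apply, lineDerivOp_apply_eq_fderiv, map_neg, sub_add_eq_sub_sub]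
    rw [h3]
    exact h2
  have hc : Continuous fun s : ℝ ↦ trans (t + s • v) (∂_{v} κ) x := by
    have := (∂_{v} κ : 𝓢(Rn n, ℂ)).continuous
    simp only [compSubConstCLM_apply]
    fun_prop
  have h3 := intervalIntegral.integral_eq_sub_of_hasDerivAt (a := 0) (b := 1)
    (fun s _ ↦ hd s) (hc.neg.intervalIntegrable _ _)
  rw [intervalIntegral.integral_neg, intervalIntegral.integral_of_le zero_le_one,
    ← integral_Icc_eq_integral_Ioc, neg_eq_iff_eq_neg] at h3
  rw [h3]
  simp [sub_add_eq_sub_sub]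

/-- The fundamental theorem of calculus for translates of κ, with f taken inside the integral over
the segment. -/
lemma corr_sub_corr (f : 𝓢'(Rn n, ℂ)) (κ : 𝓢(Rn n, ℂ)) (t v : Rn n) :
    corr f κ t - corr f κ (t + v) = ∫ s in Set.Icc (0 : ℝ) 1, corr f (∂_{v} κ) (t + s • v) := by
  have hc : Continuous fun s : ℝ ↦ trans (t + s • v) (∂_{v} κ : 𝓢(Rn n, ℂ)) :=
    (continuous_trans _).comp (f := fun s : ℝ ↦ t + s • v) (by fun_prop)
  have key := temperedDistribution_integral (μ := volume.restrict (Set.Icc (0 : ℝ) 1)) f hc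
    (fun m ↦ ((continuous_schwartzSup m).comp hc).continuousOn.integrableOn_compact isCompact_Icc)
    (trans_sub_trans_apply κ t v)
  rw [map_sub] at key
  exact key

/-- The derivative of `corr f κ`. -/
def corrFDeriv (f : 𝓢'(Rn n, ℂ)) (κ : 𝓢(Rn n, ℂ)) (t : Rn n) : Rn n →L[ℝ] ℂ :=
  ∑ i : Fin n, (EuclideanSpace.proj i : Rn n →L[ℝ] ℝ).smulRight
    (-corr f (∂_{EuclideanSpace.single i (1 : ℝ)} κ) t)

lemma corrFDeriv_apply (f : 𝓢'(Rn n, ℂ)) (κ : 𝓢(Rn n, ℂ)) (t v : Rn n) :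
    corrFDeriv f κ t v = -corr f (∂_{v} κ) t := by
  have hv : (∂_{v} κ : 𝓢(Rn n, ℂ)) =
      ∑ i : Fin n, ((v i : ℝ) : ℂ) • (∂_{EuclideanSpace.single i (1 : ℝ)} κ : 𝓢(Rn n, ℂ)) := by
    ext x
    have h : v = ∑ i, v i • EuclideanSpace.single i (1 : ℝ) := by
      simpa using ((EuclideanSpace.basisFun (Fin n) ℝ).sum_repr v).symm
    rw [_root_.sum_apply, lineDerivOp_apply_eq_fderiv]
    conv_lhs => rw [h, map_sum]
    refine Finset.sum_congr rfl fun i _ ↦ ?_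
    rw [map_smul, _root_.smul_apply, lineDerivOp_apply_eq_fderiv, Complex.real_smul, smul_eq_mul]
  have hlin : ∀ G : 𝓢(Rn n, ℂ), corr f G t = (f.toLinearMap ∘ₗ
      (compSubConstCLM ℂ t : 𝓢(Rn n, ℂ) →L[ℂ] 𝓢(Rn n, ℂ)).toLinearMap) G := fun _ ↦ rfl
  rw [hlin, hv, map_sum]
  rw [corrFDeriv, _root_.sum_apply, ← Finset.sum_neg_distrib]
  refine Finset.sum_congr rfl fun i _ ↦ ?_
  rw [LinearMap.map_smul, ← hlin, ContinuousLinearMap.smulRight_apply, Complex.real_smul,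
    smul_eq_mul, mul_neg]
  rfl

lemma continuous_corrFDeriv (f : 𝓢'(Rn n, ℂ)) (κ : 𝓢(Rn n, ℂ)) : Continuous (corrFDeriv f κ) := by
  refine continuous_finsetSum _ fun i _ ↦ ?_
  exact ((ContinuousLinearMap.smulRightL ℝ (Rn n) ℂ _).continuous).comp (continuous_corr f _).neg

/-- By `corr_sub_corr` the first-order remainder is the average over the segment of the change in
the candidate derivative, applied to v. Continuity of the candidate makes it o(|v|). -/
lemma hasFDerivAt_corr (f : 𝓢'(Rn n, ℂ)) (κ : 𝓢(Rn n, ℂ)) (t : Rn n) :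
    HasFDerivAt (corr f κ) (corrFDeriv f κ t) t := by
  rw [hasFDerivAt_iff_isLittleO_nhds_zero, Asymptotics.isLittleO_iff]
  intro ε hε
  obtain ⟨δ, hδ, h⟩ := Metric.continuousAt_iff.1 (continuous_corrFDeriv f κ).continuousAt ε hε
  filter_upwards [Metric.ball_mem_nhds (0 : Rn n) hδ] with v hv
  have hint : ∀ t : Rn n, IntegrableOn (fun s : ℝ ↦ corr f (∂_{v} κ) (t + s • v))
      (Set.Icc (0 : ℝ) 1) := fun t ↦ by
    refine Continuous.integrableOn_Icc ?_
    exact (continuous_corr f _).comp (by fun_prop)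
  have h1 : corr f κ (t + v) - corr f κ t - corrFDeriv f κ t v =
      ∫ s in Set.Icc (0 : ℝ) 1, (corrFDeriv f κ (t + s • v) - corrFDeriv f κ t) v := by
    simp only [_root_.sub_apply, corrFDeriv_apply]
    have h2 : Integrable (fun s : ℝ ↦ -corr f (∂_{v} κ) (t + s • v))
      (volume.restrict (Set.Icc (0 : ℝ) 1)) := (hint t).neg
    rw [integral_sub h2 (integrable_const _), integral_neg, ← corr_sub_corr]
    simp
  rw [h1]
  refine (norm_setIntegral_le_of_norm_le_const (C := ε * ‖v‖) (by simp) fun s hs ↦ ?_).trans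
    (by simp)
  refine (ContinuousLinearMap.le_opNorm _ _).trans ?_
  gcongr
  rw [← dist_eq_norm]
  refine (h ?_).le
  rw [dist_self_add_left, norm_smul, Real.norm_of_nonneg hs.1]
  exact (mul_le_of_le_one_left (norm_nonneg _) hs.2).trans_lt (by simpa using hv)

/-- The derivative of `corr f κ` is built from functions `corr f` of derivatives of κ; hence the
induction runs over all κ at once. -/
lemma contDiff_corr (f : 𝓢'(Rn n, ℂ)) (l : ℕ) : ∀ κ : 𝓢(Rn n, ℂ), ContDiff ℝ l (corr f κ) := by
  induction l with
  | zero => exact fun κ ↦ contDiff_zero.2 (continuous_corr f κ)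
  | succ l ih =>
    intro κ
    have h1 : fderiv ℝ (corr f κ) = corrFDeriv f κ := funext fun t ↦ (hasFDerivAt_corr f κ t).fderiv
    push_cast
    refine contDiff_succ_iff_fderiv.2 ⟨fun t ↦ (hasFDerivAt_corr f κ t).differentiableAt,
      by simp, ?_⟩
    rw [h1]
    exact ContDiff.sum fun i _ ↦ contDiff_const.smulRight (ih _).neg

lemma exists_norm_iteratedFDeriv_corr_le (f : 𝓢'(Rn n, ℂ)) (l : ℕ) : ∀ κ : 𝓢(Rn n, ℂ),
    ∃ (k : ℕ) (C : ℝ), ∀ t, ‖iteratedFDeriv ℝ l (corr f κ) t‖ ≤ C * (1 + ‖t‖) ^ k := by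
  induction l with
  | zero =>
    intro κ
    obtain ⟨k, C, -, h⟩ := exists_norm_corr_le f κ
    exact ⟨k, C, fun t ↦ by simpa using h t⟩
  | succ l ih =>
    intro κ
    have h1 : fderiv ℝ (corr f κ) = corrFDeriv f κ := funext fun t ↦ (hasFDerivAt_corr f κ t).fderiv
    choose k C h using fun i : Fin n ↦ ih (∂_{EuclideanSpace.single i (1 : ℝ)} κ)
    let B : Fin n → ℂ →L[ℝ] Rn n →L[ℝ] ℂ := fun i ↦
      -ContinuousLinearMap.smulRightL ℝ (Rn n) ℂ (EuclideanSpace.proj i)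
    have h2 : corrFDeriv f κ = fun t ↦
        ∑ i, (B i ∘ corr f (∂_{EuclideanSpace.single i (1 : ℝ)} κ)) t := by
      funext t
      ext v
      simp [corrFDeriv, B]
    -- The sum of the exponents dominates each of them, and the absolute values are there because
    -- the C i carry no sign information.
    refine ⟨∑ i, k i, ∑ i, ‖B i‖ * |C i|, fun t ↦ ?_⟩
    rw [← norm_iteratedFDeriv_fderiv, h1, h2, iteratedFDeriv_fun_sum_apply fun i _ ↦
      ((B i).contDiff.comp (contDiff_corr f l _)).contDiffAt, Finset.sum_mul]
    refine (norm_sum_le _ _).trans (Finset.sum_le_sum fun i _ ↦ ?_)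
    refine ((B i).norm_iteratedFDeriv_comp_left (contDiff_corr f l _).contDiffAt le_rfl).trans ?_
    rw [mul_assoc]
    gcongr
    refine (h i t).trans ?_
    have ht : 1 ≤ 1 + ‖t‖ := by linarith [norm_nonneg t]
    gcongr
    · exact le_abs_self _
    · exact Finset.single_le_sum (f := k) (fun _ _ ↦ Nat.zero_le _) (Finset.mem_univ i)

lemma hasTemperateGrowth_corr (f : 𝓢'(Rn n, ℂ)) (κ : 𝓢(Rn n, ℂ)) :
    (corr f κ).HasTemperateGrowth :=
  ⟨contDiff_infty.2 fun l ↦ contDiff_corr f l κ, fun l ↦ exists_norm_iteratedFDeriv_corr_le f l κ⟩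

end Smoothness

end Convolution

end ModulationSpace

end

/-! ### Minkowski's integral inequality for extended nonnegative functions. -/

noncomputable section

namespace ModulationSpace

section Minkowski

variable {X Y : Type*} [MeasurableSpace X] [MeasurableSpace Y] {μ : Measure X} {ν : Measure Y}

/-- Turns superlevel sets of an essential supremum into a condition on measures of sections, which
makes it measurable in a parameter. -/
lemma lt_essSup_iff {f : X → ℝ≥0∞} {c : ℝ≥0∞} : c < essSup f μ ↔ μ {x | c < f x} ≠ 0 := by
  rw [← not_le, not_iff_comm, not_not]
  have h : μ {x | c < f x} = 0 ↔ ∀ᵐ x ∂μ, f x ≤ c := by simp [ae_iff]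
  rw [h]
  refine ⟨fun h ↦ essSup_le_of_ae_le c h, fun h ↦ ?_⟩
  filter_upwards [ENNReal.ae_le_essSup f] with x hx using hx.trans h

lemma measurable_eLpNorm_left [SFinite μ] {F : X → Y → ℝ≥0∞} (hF : Measurable (Function.uncurry F))
    (p : ℝ≥0∞) : Measurable fun y ↦ eLpNorm (fun x ↦ F x y) p μ := by
  rcases eq_or_ne p 0 with rfl | h0
  · simp
  rcases eq_or_ne p ∞ with rfl | ht
  · simp only [eLpNorm_exponent_top, eLpNormEssSup, enorm_eq_self]
    refine measurable_of_Ioi fun c ↦ ?_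
    have h : (fun y ↦ essSup (fun x ↦ F x y) μ) ⁻¹' Set.Ioi c =
        {y | μ ((fun x ↦ (x, y)) ⁻¹' {z | c < Function.uncurry F z}) ≠ 0} := by
      ext y
      exact lt_essSup_iff
    rw [h]
    exact (measurable_measure_prodMk_right (hF measurableSet_Ioi))
      (measurableSet_singleton (0 : ℝ≥0∞)).compl
  · simp only [eLpNorm_eq_lintegral_rpow_enorm_toReal h0 ht, enorm_eq_self]
    exact (Measurable.lintegral_prod_left (hF.pow_const _)).pow_const _

lemma eLpNorm_lintegral_le_top [SFinite μ] [SFinite ν] {F : X → Y → ℝ≥0∞}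
    (hF : Measurable (Function.uncurry F)) :
    eLpNorm (fun x ↦ ∫⁻ y, F x y ∂ν) ∞ μ ≤ ∫⁻ y, eLpNorm (fun x ↦ F x y) ∞ μ ∂ν := by
  have hM := measurable_eLpNorm_left (μ := μ) hF ∞
  set M := fun y ↦ eLpNorm (fun x ↦ F x y) ∞ μ
  have h1 : ∀ᵐ z ∂(ν.prod μ), F z.2 z.1 ≤ M z.1 := by
    have hs : MeasurableSet {z : Y × X | F z.2 z.1 ≤ M z.1} :=
      measurableSet_le (hF.comp measurable_swap) (hM.comp measurable_fst)
    refine (Measure.ae_prod_iff_ae_ae hs).2 (.of_forall fun y ↦ ?_)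
    have := ENNReal.ae_le_essSup (μ := μ) fun x ↦ F x y
    simpa [M, eLpNorm_exponent_top, eLpNormEssSup] using this
  have h2 : ∀ᵐ z ∂(μ.prod ν), F z.1 z.2 ≤ M z.2 :=
    (Measure.measurePreserving_swap (μ := μ) (ν := ν)).quasiMeasurePreserving.ae h1
  have h3 := Measure.ae_ae_of_ae_prod h2
  simp only [eLpNorm_exponent_top, eLpNormEssSup, enorm_eq_self]
  refine essSup_le_of_ae_le _ ?_
  filter_upwards [h3] with x hx
  exact lintegral_mono_ae hx

/-- Avoids duality: Hölder for F = (F w^{-1/r'}) w^{1/r'} gives (∫ F dy)^r ≤ (∫ F^r w^{1-r} dy) (∫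
w)^{r-1}. Integrating in x and using the bound of the r-th power integral by w^r leaves ∫ w.
Negative powers of w require w ≠ 0. -/
lemma lintegral_rpow_lintegral_le [SFinite μ] [SFinite ν] {F : X → Y → ℝ≥0∞}
    (hF : Measurable (Function.uncurry F)) {r : ℝ} (hr : 1 < r) {w : Y → ℝ≥0∞} (hw : Measurable w)
    (hw0 : ∀ y, w y ≠ 0) (hwt : ∫⁻ y, w y ∂ν ≠ ∞) (h : ∀ y, ∫⁻ x, F x y ^ r ∂μ ≤ w y ^ r) :
    ∫⁻ x, (∫⁻ y, F x y ∂ν) ^ r ∂μ ≤ (∫⁻ y, w y ∂ν) ^ r := by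
  have hr0 : 0 < r := zero_lt_one.trans hr
  have hconj := Real.HolderConjugate.conjExponent hr
  set r' := Real.conjExponent r
  have hr' : 0 < r' := hconj.symm.pos
  have hrr : r / r' = r - 1 := by
    have := hconj.sub_one_mul_conj
    rw [div_eq_iff hr'.ne', this]
  have hwf : ∀ᵐ y ∂ν, w y < ∞ := ae_lt_top hw hwt
  have hpt : ∀ x, (∫⁻ y, F x y ∂ν) ^ r ≤
      (∫⁻ y, F x y ^ r * w y ^ (1 - r) ∂ν) * (∫⁻ y, w y ∂ν) ^ (r - 1) := by
    intro x
    have hFx : Measurable (F x) := hF.comp measurable_prodMk_left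
    have h1 : ∫⁻ y, F x y ∂ν = ∫⁻ y, ((fun y ↦ F x y * w y ^ (-(1 / r'))) *
        fun y ↦ w y ^ (1 / r')) y ∂ν := by
      refine lintegral_congr_ae ?_
      filter_upwards [hwf] with y hy
      rw [Pi.mul_apply, mul_assoc, ← ENNReal.rpow_add _ _ (hw0 y) hy.ne, neg_add_cancel,
        ENNReal.rpow_zero, mul_one]
    have h2 := ENNReal.lintegral_mul_le_Lp_mul_Lq ν hconj
      (f := fun y ↦ F x y * w y ^ (-(1 / r'))) (g := fun y ↦ w y ^ (1 / r'))
      (by fun_prop) (by fun_prop)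
    rw [← h1] at h2
    have h3 : ∀ y, (F x y * w y ^ (-(1 / r'))) ^ r = F x y ^ r * w y ^ (1 - r) := by
      intro y
      rw [ENNReal.mul_rpow_of_nonneg _ _ hr0.le, ← ENNReal.rpow_mul]
      congr 2
      rw [neg_mul, one_div_mul_eq_div, hrr]
      ring
    have h4 : ∀ y, (w y ^ (1 / r')) ^ r' = w y := by
      intro y
      rw [← ENNReal.rpow_mul, one_div, inv_mul_cancel₀ hr'.ne', ENNReal.rpow_one]
    simp only [h3, h4] at h2
    calc _ ≤ ((∫⁻ y, F x y ^ r * w y ^ (1 - r) ∂ν) ^ (1 / r) * (∫⁻ y, w y ∂ν) ^ (1 / r')) ^ r := by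
          gcongr
      _ = _ := by
          rw [ENNReal.mul_rpow_of_nonneg _ _ hr0.le, ← ENNReal.rpow_mul, ← ENNReal.rpow_mul,
            one_div_mul_cancel hr0.ne', ENNReal.rpow_one, one_div_mul_eq_div, hrr]
  have hm : Measurable (Function.uncurry fun x y ↦ F x y ^ r * w y ^ (1 - r)) :=
    (hF.pow_const r).mul ((hw.comp measurable_snd).pow_const (1 - r))
  calc _ ≤ ∫⁻ x, (∫⁻ y, F x y ^ r * w y ^ (1 - r) ∂ν) * (∫⁻ y, w y ∂ν) ^ (r - 1) ∂μ :=
        lintegral_mono hpt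
    _ = (∫⁻ x, ∫⁻ y, F x y ^ r * w y ^ (1 - r) ∂ν ∂μ) * (∫⁻ y, w y ∂ν) ^ (r - 1) :=
        lintegral_mul_const _ hm.lintegral_prod_right
    _ = (∫⁻ y, (∫⁻ x, F x y ^ r ∂μ) * w y ^ (1 - r) ∂ν) * (∫⁻ y, w y ∂ν) ^ (r - 1) := by
        rw [lintegral_lintegral_swap hm.aemeasurable]
        congr 1
        refine lintegral_congr fun y ↦ lintegral_mul_const _ ?_
        exact (hF.comp measurable_prodMk_right).pow_const r
    _ ≤ (∫⁻ y, w y ∂ν) * (∫⁻ y, w y ∂ν) ^ (r - 1) := by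
        gcongr ?_ * _
        refine lintegral_mono_ae ?_
        filter_upwards [hwf] with y hy
        calc _ ≤ w y ^ r * w y ^ (1 - r) := by gcongr; exact h y
          _ = w y := by
            rw [← ENNReal.rpow_add _ _ (hw0 y) hy.ne, add_sub_cancel, ENNReal.rpow_one]
    _ = _ := by
        nth_rewrite 1 [← ENNReal.rpow_one (∫⁻ y, w y ∂ν)]
        rw [← ENNReal.rpow_add_of_nonneg _ _ zero_le_one (by linarith), add_sub_cancel]

/-- **Minkowski's integral inequality**. -/
theorem eLpNorm_lintegral_le [SFinite μ] [SigmaFinite ν] {F : X → Y → ℝ≥0∞}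
    (hF : Measurable (Function.uncurry F)) {p : ℝ≥0∞} (hp : 1 ≤ p) :
    eLpNorm (fun x ↦ ∫⁻ y, F x y ∂ν) p μ ≤ ∫⁻ y, eLpNorm (fun x ↦ F x y) p μ ∂ν := by
  rcases eq_or_ne p ∞ with rfl | ht
  · exact eLpNorm_lintegral_le_top hF
  rcases hp.eq_or_lt with rfl | hp1
  · simp only [eLpNorm_one_eq_lintegral_enorm, enorm_eq_self]
    rw [lintegral_lintegral_swap hF.aemeasurable]
  have h0 : p ≠ 0 := (zero_lt_one.trans hp1).ne'
  have hr : 1 < p.toReal := by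
    rw [← ENNReal.toReal_one]
    exact (ENNReal.toReal_lt_toReal ENNReal.one_ne_top ht).2 hp1
  have hr0 : 0 < p.toReal := zero_lt_one.trans hr
  have hM := measurable_eLpNorm_left (μ := μ) hF p
  set M := fun y ↦ eLpNorm (fun x ↦ F x y) p μ with hMdef
  refine ENNReal.le_of_forall_pos_le_add fun ε hε hfin ↦ ?_
  -- The norm of a section may vanish, so a strictly positive v of integral below ε is added to
  -- obtain an admissible w.
  obtain ⟨v, hv0, hv, hvε⟩ := exists_pos_lintegral_lt_of_sigmaFinite ν
    (ENNReal.coe_ne_zero.2 hε.ne' : (ε : ℝ≥0∞) ≠ 0)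
  have hsum : ∫⁻ y, (M y + v y) ∂ν ≤ (∫⁻ y, M y ∂ν) + ε := by
    rw [lintegral_add_left hM]
    gcongr
  have key := lintegral_rpow_lintegral_le (μ := μ) (ν := ν) hF hr (w := fun y ↦ M y + v y)
    (by fun_prop) (fun y ↦ by simp [(hv0 y).ne'])
    (hsum.trans_lt (ENNReal.add_lt_top.2 ⟨hfin, ENNReal.coe_lt_top⟩)).ne (fun y ↦ ?_)
  · refine le_trans ?_ hsum
    rw [eLpNorm_eq_lintegral_rpow_enorm_toReal h0 ht]
    simp only [enorm_eq_self]
    rw [one_div, ENNReal.rpow_inv_le_iff hr0]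
    exact key
  · calc ∫⁻ x, F x y ^ p.toReal ∂μ = M y ^ p.toReal := by
          simp only [hMdef, eLpNorm_eq_lintegral_rpow_enorm_toReal h0 ht, enorm_eq_self]
          rw [← ENNReal.rpow_mul, one_div_mul_cancel hr0.ne', ENNReal.rpow_one]
      _ ≤ _ := by gcongr; exact le_self_add

end Minkowski

end ModulationSpace

end

/-! ### Frequency weights and the trilinear estimate. -/

noncomputable section

namespace ModulationSpace

section ENNRealLp

variable {X : Type*} [MeasurableSpace X] {μ : Measure X}

lemma eLpNorm_const_mul_ennreal {f : X → ℝ≥0∞} (hf : Measurable f) (c : ℝ≥0∞) {p : ℝ≥0∞}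
    (hp : 1 ≤ p) : eLpNorm (fun x ↦ c * f x) p μ = c * eLpNorm f p μ := by
  have h0 : p ≠ 0 := (zero_lt_one.trans_le hp).ne'
  rcases eq_or_ne p ∞ with rfl | ht
  · simp only [eLpNorm_exponent_top, eLpNormEssSup, enorm_eq_self]
    exact ENNReal.essSup_const_mul
  · have hr : 0 < p.toReal := ENNReal.toReal_pos h0 ht
    simp only [eLpNorm_eq_lintegral_rpow_enorm_toReal h0 ht, enorm_eq_self,
      ENNReal.mul_rpow_of_nonneg _ _ hr.le]
    rw [lintegral_const_mul _ (hf.pow_const _), ENNReal.mul_rpow_of_nonneg _ _ (by positivity),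
      ← ENNReal.rpow_mul, mul_one_div_cancel hr.ne', ENNReal.rpow_one]

lemma ae_lt_top_of_eLpNorm_lt_top {f : X → ℝ≥0∞} (hf : Measurable f) {p : ℝ≥0∞} (hp : 1 ≤ p)
    (h : eLpNorm f p μ < ∞) : ∀ᵐ x ∂μ, f x < ∞ := by
  have h0 : p ≠ 0 := (zero_lt_one.trans_le hp).ne'
  rcases eq_or_ne p ∞ with rfl | ht
  · simp only [eLpNorm_exponent_top, eLpNormEssSup, enorm_eq_self] at h
    filter_upwards [ENNReal.ae_le_essSup f] with x hx using hx.trans_lt h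
  · have hr : 0 < p.toReal := ENNReal.toReal_pos h0 ht
    have h1 := lintegral_rpow_enorm_lt_top_of_eLpNorm_lt_top h0 ht h
    simp only [enorm_eq_self] at h1
    filter_upwards [ae_lt_top (hf.pow_const _) h1.ne] with x hx
    by_contra hx'
    rw [not_lt, top_le_iff] at hx'
    simp [hx', hr] at hx

end ENNRealLp

variable {n : ℕ}

instance : (volume : Measure (Rn n × Rn n)).IsAddLeftInvariant :=
  inferInstanceAs ((volume : Measure (Rn n)).prod volume).IsAddLeftInvariant

section Bracket

lemma bracket_pos (ξ : Rn n) : 0 < bracket ξ := by unfold bracket; positivity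

lemma bracket_add_le (x y : Rn n) : bracket (x + y) ≤ Real.sqrt 2 * (bracket x * bracket y) := by
  unfold bracket
  rw [← Real.sqrt_mul (by positivity), ← Real.sqrt_mul (by positivity)]
  refine Real.sqrt_le_sqrt ?_
  have h1 := norm_add_le x y
  have h2 : ‖x + y‖ ^ 2 ≤ (‖x‖ + ‖y‖) ^ 2 := by gcongr
  nlinarith [sq_nonneg (‖x‖ - ‖y‖), mul_nonneg (sq_nonneg ‖x‖) (sq_nonneg ‖y‖)]

lemma bracket_le_one_add (x : Rn n) : bracket x ≤ 1 + ‖x‖ := by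
  unfold bracket
  refine Real.sqrt_le_iff.2 ⟨by positivity, ?_⟩
  nlinarith [norm_nonneg x]

lemma bracket_neg (x : Rn n) : bracket (-x) = bracket x := by simp [bracket]

/-- With η' = τ + ξ - η one has ⟨η'⟩ ≤ 2 ⟨ξ⟩⟨η⟩(1 + |τ|). Raising to the power |s| = -s and
inverting splits the output weight between the factors. -/
lemma bracket_rpow_le {s : ℝ} (hs : s ≤ 0) {K : ℕ} (hK : |s| ≤ K) (ξ η τ : Rn n) :
    bracket ξ ^ s ≤ 2 ^ |s| * (1 + ‖τ‖) ^ K * bracket η ^ |s| * bracket (τ + (ξ - η)) ^ s := by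
  have h1 : bracket (τ + (ξ - η)) ≤ 2 * (bracket ξ * bracket η * (1 + ‖τ‖)) := by
    have h2 := bracket_add_le τ (ξ - η)
    have h3 := bracket_add_le ξ (-η)
    rw [bracket_neg, ← sub_eq_add_neg] at h3
    have hb1 := bracket_pos ξ
    have hb2 := bracket_pos η
    have hb3 := bracket_pos τ
    calc _ ≤ Real.sqrt 2 * (bracket τ * (Real.sqrt 2 * (bracket ξ * bracket η))) := by
          refine h2.trans ?_
          gcongr
      _ = (Real.sqrt 2 * Real.sqrt 2) * (bracket ξ * bracket η * bracket τ) := by ring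
      _ ≤ _ := by
        rw [Real.mul_self_sqrt (by norm_num)]
        gcongr
        exact bracket_le_one_add τ
  have hb1 := bracket_pos ξ
  have hb2 := bracket_pos η
  have hb3 := bracket_pos (τ + (ξ - η))
  have h4 := Real.rpow_le_rpow hb3.le h1 (abs_nonneg s)
  rw [Real.mul_rpow (by norm_num) (by positivity), Real.mul_rpow (by positivity) (by positivity),
    Real.mul_rpow (by positivity) (by positivity)] at h4
  have h5 : (1 + ‖τ‖) ^ |s| ≤ (1 + ‖τ‖) ^ K := by
    rw [← Real.rpow_natCast]
    exact Real.rpow_le_rpow_of_exponent_le (by linarith [norm_nonneg τ]) hK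
  have h6 : s = -|s| := by rw [abs_of_nonpos hs, neg_neg]
  have e1 : bracket ξ ^ s = (bracket ξ ^ |s|)⁻¹ := by
    rw [← Real.rpow_neg hb1.le, ← h6]
  have e2 : bracket (τ + (ξ - η)) ^ s = (bracket (τ + (ξ - η)) ^ |s|)⁻¹ := by
    rw [← Real.rpow_neg hb3.le, ← h6]
  rw [e1, e2, ← div_eq_mul_inv, inv_le_iff_one_le_mul₀ (by positivity), div_mul_eq_mul_div,
    one_le_div (by positivity)]
  calc _ ≤ _ := h4
    _ ≤ 2 ^ |s| * (bracket ξ ^ |s| * bracket η ^ |s| * (1 + ‖τ‖) ^ K) := by gcongr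
    _ = _ := by ring

lemma continuous_bracket_rpow (s : ℝ) : Continuous fun ξ : Rn n ↦ bracket ξ ^ s := by
  have h : Continuous fun ξ : Rn n ↦ bracket ξ := by unfold bracket; fun_prop
  exact h.rpow_const fun ξ ↦ Or.inl (bracket_pos ξ).ne'

end Bracket

section TrilinearForm

/-- The extended-nonnegative-real valued weight. -/
def ewt (N : ℕ) (x : Rn n) : ℝ≥0∞ := ENNReal.ofReal (wt N x)

lemma measurable_ewt (N : ℕ) : Measurable (ewt N : Rn n → ℝ≥0∞) :=
  (continuous_wt N).measurable.ennreal_ofReal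

lemma lintegral_ewt_lt_top {N : ℕ} (hN : n < N) : ∫⁻ x : Rn n, ewt N x < ∞ :=
  (integrable_wt hN).lintegral_lt_top

/-- The majorant of the short-time Fourier transform of a product. -/
def majorant (N : ℕ) (F G : Rn n × Rn n → ℂ) (x ξ : Rn n) : ℝ≥0∞ :=
  ∫⁻ z : Rn n × Rn n, ∫⁻ z' : Rn n × Rn n, ‖F z‖ₑ * ‖G z'‖ₑ *
    (ewt N (z.1 - x) * ewt N (z'.1 - x) * ewt N (z.2 + z'.2 - ξ))

/-- The mixed norm `L^q_ξ L^p_x` with weight `⟨ξ⟩^s`. -/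
def mixedNorm (s : ℝ) (p q : ℝ≥0∞) (F : Rn n × Rn n → ℝ≥0∞) : ℝ≥0∞ :=
  eLpNorm (fun ξ : Rn n ↦ ENNReal.ofReal (bracket ξ ^ s) *
    eLpNorm (fun x : Rn n ↦ F (x, ξ)) p volume) q volume

lemma modNorm_eq (φ : 𝓢(Rn n, ℂ)) (s : ℝ) (p q : ℝ≥0∞) (f : 𝓢'(Rn n, ℂ)) :
    modNorm φ s p q f = mixedNorm s p q fun z ↦ ‖stft φ f z.1 z.2‖ₑ := by
  unfold modNorm mixedNorm
  congr 1 with ξ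
  have h : (fun x : Rn n ↦ stft φ f x ξ * ((bracket ξ ^ s : ℝ) : ℂ)) =
      ((bracket ξ ^ s : ℝ) : ℂ) • fun x ↦ stft φ f x ξ := by
    ext x
    simp [mul_comm]
  rw [h, eLpNorm_const_smul, eLpNorm_enorm]
  congr 1
  have h0 := Real.rpow_nonneg (bracket_pos ξ).le s
  rw [← ofReal_norm, Complex.norm_real, Real.norm_of_nonneg h0]

variable {F G : Rn n × Rn n → ℂ}

/-- Hölder together with translation invariance of the Lebesgue norms. -/
lemma eLpNorm_translate_mul_le (hF : Continuous F) (hG : Continuous G) {p p₁ p₂ : ℝ≥0∞}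
    (hp : p⁻¹ = p₁⁻¹ + p₂⁻¹) (z z' : Rn n × Rn n) (c : ℝ) :
    eLpNorm (fun x ↦ ‖F (x + z.1, z.2)‖ₑ * ‖G (x + z'.1, z'.2)‖ₑ * ENNReal.ofReal c) p volume ≤
      eLpNorm (fun x ↦ ‖F (x, z.2)‖ₑ) p₁ volume * eLpNorm (fun x ↦ ‖G (x, z'.2)‖ₑ) p₂ volume *
        ENNReal.ofReal c := by
  have : p₁.HolderTriple p₂ p := ⟨hp.symm⟩
  rcases le_total c 0 with hc | hc
  · simp [ENNReal.ofReal_of_nonpos hc]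
  have hF' : Continuous fun x ↦ F (x, z.2) := by fun_prop
  have hG' : Continuous fun x ↦ G (x, z'.2) := by fun_prop
  have h1 : ∀ x, ‖F (x + z.1, z.2)‖ₑ * ‖G (x + z'.1, z'.2)‖ₑ * ENNReal.ofReal c =
      ‖((c : ℂ) • ((fun x ↦ F (x + z.1, z.2)) • fun x ↦ G (x + z'.1, z'.2))) x‖ₑ := by
    intro x
    have hc' : ‖(c : ℂ)‖ₑ = ENNReal.ofReal c := by
      rw [← ofReal_norm, Complex.norm_real, Real.norm_of_nonneg hc]
    change _ = ‖(c : ℂ) * (F (x + z.1, z.2) * G (x + z'.1, z'.2))‖ₑ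
    rw [enorm_mul, enorm_mul, hc', mul_comm]
  simp_rw [h1]
  rw [eLpNorm_enorm, eLpNorm_const_smul, eLpNorm_enorm, eLpNorm_enorm, mul_comm,
    ← ofReal_norm, Complex.norm_real, Real.norm_of_nonneg hc]
  gcongr
  refine (eLpNorm_smul_le_mul_eLpNorm (p := p₁) (q := p₂) (r := p)
    (by fun_prop : Continuous fun x ↦ G (x + z'.1, z'.2)).aestronglyMeasurable
    (by fun_prop : Continuous fun x ↦ F (x + z.1, z.2)).aestronglyMeasurable).trans_eq ?_
  congr 1
  · exact eLpNorm_comp_measurePreserving hF'.aestronglyMeasurable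
      (measurePreserving_add_right volume z.1)
  · exact eLpNorm_comp_measurePreserving hG'.aestronglyMeasurable
      (measurePreserving_add_right volume z'.1)

/-- After recentring, x enters only through F and G, so Minkowski can be applied with the weights as
constants. -/
lemma majorant_eq_translate (N : ℕ) (F G : Rn n × Rn n → ℂ) (x ξ : Rn n) :
    majorant N F G x ξ = ∫⁻ z : Rn n × Rn n, ∫⁻ z' : Rn n × Rn n,
      ‖F (x + z.1, z.2)‖ₑ * ‖G (x + z'.1, z'.2)‖ₑ *
        (ewt N z.1 * ewt N z'.1 * ewt N (z.2 + z'.2 - ξ)) := by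
  rw [majorant, ← lintegral_add_left_eq_self _ ((x, 0) : Rn n × Rn n)]
  refine lintegral_congr fun z ↦ ?_
  rw [← lintegral_add_left_eq_self _ ((x, 0) : Rn n × Rn n)]
  refine lintegral_congr fun z' ↦ ?_
  simp [Prod.add_def]

/-- Minkowski in z and z' reduces to the Hölder bound for each fixed pair; the two position weights
then integrate out and give the squared constant. -/
lemma eLpNorm_majorant_le (hF : Continuous F) (hG : Continuous G) {p p₁ p₂ : ℝ≥0∞} (h1 : 1 ≤ p)
    (hp : p⁻¹ = p₁⁻¹ + p₂⁻¹) (N : ℕ) (ξ : Rn n) :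
    eLpNorm (fun x ↦ majorant N F G x ξ) p volume ≤ (∫⁻ x : Rn n, ewt N x) ^ 2 *
      ∫⁻ η, ∫⁻ η', eLpNorm (fun x ↦ ‖F (x, η)‖ₑ) p₁ volume *
        eLpNorm (fun x ↦ ‖G (x, η')‖ₑ) p₂ volume * ewt N (η + η' - ξ) := by
  set A : Rn n → ℝ≥0∞ := fun η ↦ eLpNorm (fun x ↦ ‖F (x, η)‖ₑ) p₁ volume
  set B : Rn n → ℝ≥0∞ := fun η ↦ eLpNorm (fun x ↦ ‖G (x, η)‖ₑ) p₂ volume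
  have hA : Measurable A := measurable_eLpNorm_left (F := fun x η ↦ ‖F (x, η)‖ₑ)
    hF.measurable.enorm p₁
  have hB : Measurable B := measurable_eLpNorm_left (F := fun x η ↦ ‖G (x, η)‖ₑ)
    hG.measurable.enorm p₂
  have hw := measurable_ewt (n := n) N
  have hFm := hF.measurable
  have hGm := hG.measurable
  simp_rw [majorant_eq_translate]
  have hk : Measurable fun v : Rn n × (Rn n × Rn n) × (Rn n × Rn n) ↦
      ‖F (v.1 + v.2.1.1, v.2.1.2)‖ₑ * ‖G (v.1 + v.2.2.1, v.2.2.2)‖ₑ *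
        (ewt N v.2.1.1 * ewt N v.2.2.1 * ewt N (v.2.1.2 + v.2.2.2 - ξ)) := by
    fun_prop
  calc _ ≤ ∫⁻ z : Rn n × Rn n, eLpNorm (fun x ↦ ∫⁻ z' : Rn n × Rn n,
      ‖F (x + z.1, z.2)‖ₑ * ‖G (x + z'.1, z'.2)‖ₑ *
        (ewt N z.1 * ewt N z'.1 * ewt N (z.2 + z'.2 - ξ))) p volume := by
        refine eLpNorm_lintegral_le ?_ h1
        refine Measurable.lintegral_prod_right (f := fun (w : Rn n × Rn n × Rn n)
          (z' : Rn n × Rn n) ↦ ‖F (w.1 + w.2.1, w.2.2)‖ₑ * ‖G (w.1 + z'.1, z'.2)‖ₑ *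
          (ewt N w.2.1 * ewt N z'.1 * ewt N (w.2.2 + z'.2 - ξ))) ?_
        exact hk.comp (f := fun v : (Rn n × Rn n × Rn n) × (Rn n × Rn n) ↦
          (v.1.1, v.1.2, v.2)) (by fun_prop)
    _ ≤ ∫⁻ z : Rn n × Rn n, ∫⁻ z' : Rn n × Rn n, A z.2 * B z'.2 *
          (ewt N z.1 * ewt N z'.1 * ewt N (z.2 + z'.2 - ξ)) := by
        refine lintegral_mono fun z ↦ (eLpNorm_lintegral_le ?_ h1).trans
          (lintegral_mono fun z' ↦ ?_)
        · exact hk.comp (f := fun v : Rn n × (Rn n × Rn n) ↦ (v.1, z, v.2)) (by fun_prop)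
        · have h2 : ewt N z.1 * ewt N z'.1 * ewt N (z.2 + z'.2 - ξ) =
              ENNReal.ofReal (wt N z.1 * wt N z'.1 * wt N (z.2 + z'.2 - ξ)) := by
            have := wt_nonneg N z.1
            have := wt_nonneg N z'.1
            rw [ENNReal.ofReal_mul (by positivity), ENNReal.ofReal_mul (by positivity)]
            rfl
          rw [h2]
          exact eLpNorm_translate_mul_le hF hG hp z z' _
    _ = ∫⁻ z : Rn n × Rn n, ewt N z.1 * ((∫⁻ x : Rn n, ewt N x) *
          ∫⁻ η', A z.2 * B η' * ewt N (z.2 + η' - ξ)) := by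
        refine lintegral_congr fun z ↦ ?_
        rw [← lintegral_prod_mul (by fun_prop) (by fun_prop), ← Measure.volume_eq_prod,
          ← lintegral_const_mul _ (by fun_prop)]
        refine lintegral_congr fun z' ↦ ?_
        ring
    _ = _ := by
        have hm : Measurable fun η ↦ (∫⁻ x : Rn n, ewt N x) *
            ∫⁻ η', A η * B η' * ewt N (η + η' - ξ) :=
          (Measurable.lintegral_prod_right (f := fun η η' ↦ A η * B η' * ewt N (η + η' - ξ))
            (by fun_prop)).const_mul _
        rw [Measure.volume_eq_prod, lintegral_prod_mul (f := ewt N) hw.aemeasurable hm.aemeasurable,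
          lintegral_const_mul, sq, mul_assoc]
        exact Measurable.lintegral_prod_right
          (f := fun η η' ↦ A η * B η' * ewt N (η + η' - ξ)) (by fun_prop)

/-- A weighted Young inequality. For fixed η and τ the integrand is a translate of the weighted B,
so Minkowski leaves the L^q norm of that and the integral of the remaining factors. -/
lemma eLpNorm_weighted_convolution_le {A B : Rn n → ℝ≥0∞} (hA : Measurable A) (hB : Measurable B)
    {q : ℝ≥0∞} (hq : 1 ≤ q) {s : ℝ} (hs : s ≤ 0) {K : ℕ} (hK : |s| ≤ K) (k : ℕ) :
    eLpNorm (fun ξ ↦ ENNReal.ofReal (bracket ξ ^ s) *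
        ∫⁻ η, ∫⁻ η', A η * B η' * ewt (K + k) (η + η' - ξ)) q volume ≤
      ENNReal.ofReal (2 ^ |s|) * (∫⁻ x : Rn n, ewt k x) *
        (∫⁻ η, ENNReal.ofReal (bracket η ^ |s|) * A η) *
        eLpNorm (fun ξ ↦ ENNReal.ofReal (bracket ξ ^ s) * B ξ) q volume := by
  have hw := measurable_ewt (n := n) k
  have hb : ∀ s : ℝ, Measurable fun ξ : Rn n ↦ ENNReal.ofReal (bracket ξ ^ s) := fun s ↦
    (continuous_bracket_rpow s).measurable.ennreal_ofReal
  have hbs := hb s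
  have hbs' := hb |s|
  set D : Rn n → ℝ≥0∞ := fun ξ ↦ ENNReal.ofReal (bracket ξ ^ s) * B ξ with hD
  have hDm : Measurable D := by fun_prop
  set c : Rn n → Rn n → ℝ≥0∞ := fun η τ ↦ ENNReal.ofReal (2 ^ |s|) *
    (ENNReal.ofReal (bracket η ^ |s|) * A η) * ewt k τ with hc
  have hcm : Measurable (Function.uncurry c) := by
    have h : Measurable fun η ↦ ENNReal.ofReal (bracket η ^ |s|) * A η := by fun_prop
    exact ((h.comp measurable_fst).const_mul _).mul (hw.comp measurable_snd)
  have hpt : ∀ ξ, ENNReal.ofReal (bracket ξ ^ s) *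
      ∫⁻ η, ∫⁻ η', A η * B η' * ewt (K + k) (η + η' - ξ) ≤
      ∫⁻ η, ∫⁻ τ, c η τ * D (τ + (ξ - η)) := by
    intro ξ
    have hwK := measurable_ewt (n := n) (K + k)
    rw [← lintegral_const_mul]
    swap
    · exact Measurable.lintegral_prod_right
        (f := fun η η' ↦ A η * B η' * ewt (K + k) (η + η' - ξ)) (by fun_prop)
    refine lintegral_mono fun η ↦ ?_
    -- Substitute η' = τ + (ξ - η): the smearing weight then depends on τ alone.
    rw [← lintegral_const_mul _ (by fun_prop), ← lintegral_add_right_eq_self _ (ξ - η)]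
    refine lintegral_mono fun τ ↦ ?_
    have h1 : η + (τ + (ξ - η)) - ξ = τ := by abel
    have h2 := ENNReal.ofReal_le_ofReal (bracket_rpow_le hs hK ξ η τ)
    have hb1 := bracket_pos η
    rw [ENNReal.ofReal_mul (by positivity), ENNReal.ofReal_mul (by positivity),
      ENNReal.ofReal_mul (by positivity)] at h2
    have h3 : ENNReal.ofReal ((1 + ‖τ‖) ^ K) * ewt (K + k) τ = ewt k τ := by
      rw [ewt, ← ENNReal.ofReal_mul (by positivity), pow_mul_wt_add, ewt]
    simp only [h1, hc, hD]
    rw [← h3]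
    calc _ ≤ (ENNReal.ofReal (2 ^ |s|) * ENNReal.ofReal ((1 + ‖τ‖) ^ K) *
          ENNReal.ofReal (bracket η ^ |s|) * ENNReal.ofReal (bracket (τ + (ξ - η)) ^ s)) *
          (A η * B (τ + (ξ - η)) * ewt (K + k) τ) := by gcongr
      _ = _ := by ring
  have hT : Measurable fun v : (Rn n × Rn n) × Rn n ↦ c v.1.2 v.2 * D (v.2 + (v.1.1 - v.1.2)) := by
    have : Measurable fun v : (Rn n × Rn n) × Rn n ↦ c v.1.2 v.2 :=
      hcm.comp (f := fun v : (Rn n × Rn n) × Rn n ↦ (v.1.2, v.2)) (by fun_prop)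
    fun_prop
  calc _ ≤ eLpNorm (fun ξ ↦ ∫⁻ η, ∫⁻ τ, c η τ * D (τ + (ξ - η))) q volume :=
        eLpNorm_mono_enorm fun ξ ↦ hpt ξ
    _ ≤ ∫⁻ η, eLpNorm (fun ξ ↦ ∫⁻ τ, c η τ * D (τ + (ξ - η))) q volume :=
        eLpNorm_lintegral_le (Measurable.lintegral_prod_right
          (f := fun (v : Rn n × Rn n) τ ↦ c v.2 τ * D (τ + (v.1 - v.2))) hT) hq
    _ ≤ ∫⁻ η, ∫⁻ τ, c η τ * eLpNorm D q volume := by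
        refine lintegral_mono fun η ↦ (eLpNorm_lintegral_le
          (F := fun ξ τ ↦ c η τ * D (τ + (ξ - η)))
          (hT.comp (f := fun v : Rn n × Rn n ↦ ((v.1, η), v.2)) (by fun_prop)) hq).trans
          (lintegral_mono fun τ ↦ ?_)
        rw [eLpNorm_const_mul_ennreal (by fun_prop) _ hq]
        have h4 : (fun ξ ↦ D (τ + (ξ - η))) = D ∘ fun ξ ↦ ξ + (τ - η) := by
          ext ξ
          simp only [Function.comp_apply]
          congr 1
          abel
        rw [h4, eLpNorm_comp_measurePreserving hDm.aestronglyMeasurable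
          (measurePreserving_add_right volume (τ - η))]
    _ = _ := by
        have h5 : ∀ η, ∫⁻ τ, c η τ * eLpNorm D q volume = (ENNReal.ofReal (2 ^ |s|) *
            (∫⁻ x : Rn n, ewt k x) * eLpNorm D q volume) *
              (ENNReal.ofReal (bracket η ^ |s|) * A η) := by
          intro η
          simp only [hc]
          rw [lintegral_mul_const _ (by fun_prop), lintegral_const_mul _ hw]
          ring
        simp_rw [h5]
        rw [lintegral_const_mul _ (by fun_prop)]
        ring

/-- The trilinear estimate behind the multiplication theorem. -/
theorem exists_mixedNorm_majorant_le {p p₁ p₂ q : ℝ≥0∞} {s : ℝ} (h1 : 1 ≤ p) (hq : 1 ≤ q)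
    (hp : p⁻¹ = p₁⁻¹ + p₂⁻¹) (hs : s ≤ 0) : ∃ (N : ℕ) (c : ℝ≥0), ∀ F G : Rn n × Rn n → ℂ,
      Continuous F → Continuous G →
      mixedNorm s p q (fun z ↦ majorant N F G z.1 z.2) ≤
        c * mixedNorm |s| p₁ 1 (fun z ↦ ‖F z‖ₑ) * mixedNorm s p₂ q (fun z ↦ ‖G z‖ₑ) := by
  obtain ⟨K, hK⟩ := exists_nat_ge |s|
  -- K powers pay for splitting the bracket, n + 1 make the remaining weight integrable.
  set N := K + (n + 1)
  set c : ℝ≥0∞ := (∫⁻ x : Rn n, ewt N x) ^ 2 *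
    (ENNReal.ofReal (2 ^ |s|) * (∫⁻ x : Rn n, ewt (n + 1) x)) with hc
  have hcf : c ≠ ∞ := by
    have h2 := lintegral_ewt_lt_top (n := n) (N := N) (by omega)
    have h3 := lintegral_ewt_lt_top (n := n) (Nat.lt_succ_self n)
    exact ENNReal.mul_ne_top (ENNReal.pow_ne_top h2.ne)
      (ENNReal.mul_ne_top ENNReal.ofReal_ne_top h3.ne)
  refine ⟨N, c.toNNReal, fun F G hF hG ↦ ?_⟩
  rw [ENNReal.coe_toNNReal hcf]
  set A : Rn n → ℝ≥0∞ := fun η ↦ eLpNorm (fun x ↦ ‖F (x, η)‖ₑ) p₁ volume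
  set B : Rn n → ℝ≥0∞ := fun η ↦ eLpNorm (fun x ↦ ‖G (x, η)‖ₑ) p₂ volume
  have hA : Measurable A := measurable_eLpNorm_left (F := fun x η ↦ ‖F (x, η)‖ₑ)
    hF.measurable.enorm p₁
  have hB : Measurable B := measurable_eLpNorm_left (F := fun x η ↦ ‖G (x, η)‖ₑ)
    hG.measurable.enorm p₂
  have hw := measurable_ewt (n := n) N
  have hconv : Measurable fun ξ ↦ ∫⁻ η, ∫⁻ η', A η * B η' * ewt N (η + η' - ξ) := by
    refine Measurable.lintegral_prod_right (f := fun ξ η ↦ ∫⁻ η', A η * B η' *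
      ewt N (η + η' - ξ)) ?_
    exact Measurable.lintegral_prod_right (f := fun (v : Rn n × Rn n) η' ↦ A v.2 * B η' *
      ewt N (v.2 + η' - v.1)) (by fun_prop)
  have hb : Measurable fun ξ : Rn n ↦ ENNReal.ofReal (bracket ξ ^ s) :=
    (continuous_bracket_rpow s).measurable.ennreal_ofReal
  calc _ ≤ eLpNorm (fun ξ ↦ (∫⁻ x : Rn n, ewt N x) ^ 2 * (ENNReal.ofReal (bracket ξ ^ s) *
          ∫⁻ η, ∫⁻ η', A η * B η' * ewt N (η + η' - ξ))) q volume := by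
        refine eLpNorm_mono_enorm fun ξ ↦ ?_
        simp only [enorm_eq_self]
        refine (mul_le_mul_right (eLpNorm_majorant_le hF hG h1 hp N ξ) _).trans_eq ?_
        ring
    _ = (∫⁻ x : Rn n, ewt N x) ^ 2 * eLpNorm (fun ξ ↦ ENNReal.ofReal (bracket ξ ^ s) *
          ∫⁻ η, ∫⁻ η', A η * B η' * ewt N (η + η' - ξ)) q volume :=
        eLpNorm_const_mul_ennreal (by fun_prop) _ hq
    _ ≤ (∫⁻ x : Rn n, ewt N x) ^ 2 * (ENNReal.ofReal (2 ^ |s|) * (∫⁻ x : Rn n, ewt (n + 1) x) *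
        (∫⁻ η, ENNReal.ofReal (bracket η ^ |s|) * A η) *
        eLpNorm (fun ξ ↦ ENNReal.ofReal (bracket ξ ^ s) * B ξ) q volume) := by
        gcongr
        exact eLpNorm_weighted_convolution_le hA hB hq hs hK (n + 1)
    _ = _ := by
        simp only [hc, mixedNorm, eLpNorm_one_eq_lintegral_enorm, enorm_eq_self]
        ring

lemma measurable_majorant (N : ℕ) (hF : Continuous F) (hG : Continuous G) :
    Measurable fun v : Rn n × Rn n ↦ majorant N F G v.1 v.2 := by
  have hw := measurable_ewt (n := n) N
  have hFm := hF.measurable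
  have hGm := hG.measurable
  refine Measurable.lintegral_prod_right (f := fun (v z : Rn n × Rn n) ↦
    ∫⁻ z' : Rn n × Rn n, ‖F z‖ₑ * ‖G z'‖ₑ *
      (ewt N (z.1 - v.1) * ewt N (z'.1 - v.1) * ewt N (z.2 + z'.2 - v.2))) ?_
  exact Measurable.lintegral_prod_right
    (f := fun (w : (Rn n × Rn n) × (Rn n × Rn n)) (z' : Rn n × Rn n) ↦ ‖F w.2‖ₑ * ‖G z'‖ₑ *
      (ewt N (w.2.1 - w.1.1) * ewt N (z'.1 - w.1.1) * ewt N (w.2.2 + z'.2 - w.1.2)))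
    (by fun_prop)

/-- Finiteness of the norm gives one point (x, ξ) with finite majorant. By Peetre, moving the base
point to the origin multiplies the three weights by constants depending only on x and ξ. -/
lemma majorant_zero_lt_top {p q : ℝ≥0∞} {s : ℝ} (h1 : 1 ≤ p) (hq : 1 ≤ q) {N : ℕ}
    (hF : Continuous F) (hG : Continuous G)
    (h : mixedNorm s p q (fun z ↦ majorant N F G z.1 z.2) < ∞) : majorant N F G 0 0 < ∞ := by
  have hm := measurable_majorant N hF hG
  have hb : Measurable fun ξ : Rn n ↦ ENNReal.ofReal (bracket ξ ^ s) :=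
    (continuous_bracket_rpow s).measurable.ennreal_ofReal
  have hn := measurable_eLpNorm_left (μ := (volume : Measure (Rn n)))
    (F := fun x ξ ↦ majorant N F G x ξ) hm p
  obtain ⟨ξ, hξ⟩ := (ae_lt_top_of_eLpNorm_lt_top (by fun_prop) hq h).exists
  have hξ' : eLpNorm (fun x : Rn n ↦ majorant N F G x ξ) p volume < ∞ := by
    by_contra hcon
    rw [not_lt, top_le_iff] at hcon
    have hpos : ENNReal.ofReal (bracket ξ ^ s) ≠ 0 :=
      (ENNReal.ofReal_pos.2 (Real.rpow_pos_of_pos (bracket_pos ξ) s)).ne'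
    rw [hcon, ENNReal.mul_top hpos] at hξ
    exact lt_irrefl _ hξ
  obtain ⟨x, hx⟩ := (ae_lt_top_of_eLpNorm_lt_top (hm.comp measurable_prodMk_right) h1 hξ').exists
  have hpeetre : ∀ a b : Rn n, ewt N a ≤ ENNReal.ofReal ((1 + ‖b‖) ^ N) * ewt N (a - b) := by
    intro a b
    rw [ewt, ewt, ← ENNReal.ofReal_mul (by positivity)]
    refine ENNReal.ofReal_le_ofReal ?_
    simpa [sub_eq_add_neg] using wt_le_pow_mul_wt_add N a (-b)
  set c : ℝ≥0∞ := ENNReal.ofReal ((1 + ‖x‖) ^ N) * ENNReal.ofReal ((1 + ‖x‖) ^ N) *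
    ENNReal.ofReal ((1 + ‖ξ‖) ^ N) with hc
  have hct : c ≠ ∞ := ENNReal.mul_ne_top (ENNReal.mul_ne_top ENNReal.ofReal_ne_top
    ENNReal.ofReal_ne_top) ENNReal.ofReal_ne_top
  have hle : majorant N F G 0 0 ≤ c * majorant N F G x ξ := by
    rw [majorant, majorant, ← lintegral_const_mul' _ _ hct]
    refine lintegral_mono fun z ↦ ?_
    rw [← lintegral_const_mul' _ _ hct]
    refine lintegral_mono fun z' ↦ ?_
    simp only [sub_zero]
    calc _ ≤ ‖F z‖ₑ * ‖G z'‖ₑ * ((ENNReal.ofReal ((1 + ‖x‖) ^ N) * ewt N (z.1 - x)) *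
          (ENNReal.ofReal ((1 + ‖x‖) ^ N) * ewt N (z'.1 - x)) *
          (ENNReal.ofReal ((1 + ‖ξ‖) ^ N) * ewt N (z.2 + z'.2 - ξ))) := by
          gcongr <;> exact hpeetre _ _
      _ = _ := by rw [hc]; ring
  exact hle.trans_lt (ENNReal.mul_lt_top hct.lt_top hx)

end TrilinearForm

end ModulationSpace

end

/-! ### The cutoffs S^j and averaged atoms. -/

noncomputable section

namespace ModulationSpace

variable {n : ℕ}

section Cutoff

/-- The dilated cutoff `w ↦ ψ (-2π ρ w)` as a Schwartz function. -/
def cutoff {ψ : Rn n → ℂ} (hψ : IsCutoff ψ) {ρ : ℝ} (hρ : 0 < ρ) : 𝓢(Rn n, ℂ) :=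
  HasCompactSupport.toSchwartzMap (f := fun w : Rn n ↦ ψ (ρ • (-(2 * Real.pi)) • w))
    (by
      have h : ρ * (-(2 * Real.pi)) ≠ 0 :=
        mul_ne_zero hρ.ne' (neg_ne_zero.2 (by positivity))
      simp_rw [smul_smul]
      exact hψ.hasCompactSupport.comp_homeomorph (Homeomorph.smulOfNeZero _ h))
    (hψ.contDiff.comp (by fun_prop))

lemma cutoff_apply {ψ : Rn n → ℂ} (hψ : IsCutoff ψ) {ρ : ℝ} (hρ : 0 < ρ) (w : Rn n) :
    cutoff hψ hρ w = ψ (ρ • (-(2 * Real.pi)) • w) := rfl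

lemma fourier_cutoff_smul {ψ : Rn n → ℂ} (hψ : IsCutoff ψ) {ρ : ℝ} (hρ : 0 < ρ) (r : Rn n) :
    𝓕 (cutoff hψ one_pos) r = (ρ : ℂ) ^ n * 𝓕 (cutoff hψ hρ) (ρ • r) := by
  have h1 : 𝓕 (cutoff hψ hρ) (ρ • r) = ∫ w, (fun w ↦ Complex.exp
      ((↑(-2 * Real.pi * inner ℝ w r) * Complex.I)) • cutoff hψ one_pos w) (ρ • w) := by
    rw [fourier_coe, Real.fourier_eq']
    refine integral_congr_ae (.of_forall fun w ↦ ?_)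
    simp only [cutoff_apply, inner_smul_left, inner_smul_right, conj_trivial, one_smul]
    rw [smul_comm ρ (-(2 * Real.pi)) w]
  rw [h1, Measure.integral_comp_smul volume (fun w ↦ Complex.exp
      ((↑(-2 * Real.pi * inner ℝ w r) * Complex.I)) • cutoff hψ one_pos w),
    finrank_euclideanSpace, Fintype.card_fin, abs_of_nonneg (by positivity), Complex.real_smul,
    ← mul_assoc]
  have h2 : (ρ : ℂ) ^ n * (((ρ ^ n)⁻¹ : ℝ) : ℂ) = 1 := by
    push_cast
    exact mul_inv_cancel₀ (pow_ne_zero _ (by exact_mod_cast hρ.ne'))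
  rw [h2, one_mul, fourier_coe, Real.fourier_eq']

/-- The scale is moved from the kernel to the argument, so that a single kernel serves all j. -/
lemma integral_mul_fourier_cutoff {ψ : Rn n → ℂ} (hψ : IsCutoff ψ) {ρ : ℝ} (hρ : 0 < ρ)
    (H : Rn n → ℂ) : ∫ r, H r * 𝓕 (cutoff hψ hρ) r =
      ∫ r, H (ρ • r) * 𝓕 (cutoff hψ one_pos) r := by
  have h1 : ∀ r, H (ρ • r) * 𝓕 (cutoff hψ one_pos) r =
      (ρ : ℂ) ^ n * (fun r ↦ H r * 𝓕 (cutoff hψ hρ) r) (ρ • r) := by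
    intro r
    rw [fourier_cutoff_smul hψ hρ]
    ring
  simp_rw [h1]
  rw [integral_const_mul, Measure.integral_comp_smul volume (fun r ↦ H r * 𝓕 (cutoff hψ hρ) r),
    finrank_euclideanSpace, Fintype.card_fin, abs_of_nonneg (by positivity), Complex.real_smul,
    ← mul_assoc]
  have h2 : (ρ : ℂ) ^ n * (((ρ ^ n)⁻¹ : ℝ) : ℂ) = 1 := by
    push_cast
    exact mul_inv_cancel₀ (pow_ne_zero _ (by exact_mod_cast hρ.ne'))
  rw [h2, one_mul]

/-- Fourier inversion at 0, where ψ equals 1. -/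
lemma integral_fourier_cutoff {ψ : Rn n → ℂ} (hψ : IsCutoff ψ) :
    ∫ r, 𝓕 (cutoff hψ one_pos) r = 1 := by
  have h1 : 𝓕⁻ (𝓕 (cutoff hψ one_pos)) 0 = ∫ r, 𝓕 (cutoff hψ one_pos) r := by
    rw [fourierInv_coe, Real.fourierInv_eq']
    simp
  rw [← h1, fourierInv_fourier_eq, cutoff_apply]
  simpa using hψ.eventually_eq_one.self_of_nhds

lemma lowPass_eq {ψ : Rn n → ℂ} (hψ : IsCutoff ψ) {j : ℕ} (hρ : 0 < ((2 : ℝ) ^ j)⁻¹)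
    (f : 𝓢'(Rn n, ℂ)) : lowPass ψ j f =
      (hasTemperateGrowth_corr f (𝓕 (cutoff hψ hρ))).toTemperedDistribution := by
  ext Φ
  exact integral_mul_corr f (cutoff hψ hρ) Φ

end Cutoff

section SmoothedAtom

/-- The average of an atom over the dilates of a kernel. -/
def smoothAtom (φ K : 𝓢(Rn n, ℂ)) (ρ : ℝ) (z : Rn n × Rn n) (t : Rn n) : ℂ :=
  ∫ r, atom φ z (t + ρ • r) * K r

lemma norm_atom_le (φ : 𝓢(Rn n, ℂ)) (z : Rn n × Rn n) (t : Rn n) :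
    ‖atom φ z t‖ ≤ SchwartzMap.seminorm ℝ 0 0 φ := by
  rw [norm_atom]
  exact SchwartzMap.norm_le_seminorm ℝ _ _

lemma norm_smoothAtom_le (φ K : 𝓢(Rn n, ℂ)) (ρ : ℝ) (z : Rn n × Rn n) (t : Rn n) :
    ‖smoothAtom φ K ρ z t‖ ≤ SchwartzMap.seminorm ℝ 0 0 φ * ∫ r, ‖K r‖ := by
  rw [smoothAtom, ← integral_const_mul]
  refine norm_integral_le_of_norm_le (K.integrable.norm.const_mul _) (.of_forall fun r ↦ ?_)
  rw [norm_mul]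
  gcongr
  exact norm_atom_le _ _ _

/-- The scale ρ = 0 is included: there a kernel of mass one returns the atom itself, so the limit in
j becomes continuity at ρ = 0. -/
lemma continuous_smoothAtom (φ K : 𝓢(Rn n, ℂ)) :
    Continuous fun p : ℝ × (Rn n × Rn n) × Rn n ↦ smoothAtom φ K p.1 p.2.1 p.2.2 := by
  have hc : Continuous fun q : (ℝ × (Rn n × Rn n) × Rn n) × Rn n ↦
      atom φ q.1.2.1 (q.1.2.2 + q.1.1 • q.2) * K q.2 := by
    have h0 : Continuous fun q : (ℝ × (Rn n × Rn n) × Rn n) × Rn n ↦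
        (q.1.2.1, q.1.2.2 + q.1.1 • q.2) := by fun_prop
    have h1 : Continuous fun q : (ℝ × (Rn n × Rn n) × Rn n) × Rn n ↦
        atom φ q.1.2.1 (q.1.2.2 + q.1.1 • q.2) := (continuous_atom φ).comp h0
    have h2 : Continuous fun q : (ℝ × (Rn n × Rn n) × Rn n) × Rn n ↦ K q.2 :=
      K.continuous.comp continuous_snd
    exact h1.mul h2
  refine continuous_of_dominated
    (F := fun (p : ℝ × (Rn n × Rn n) × Rn n) r ↦ atom φ p.2.1 (p.2.2 + p.1 • r) * K r)
    (bound := fun r ↦ SchwartzMap.seminorm ℝ 0 0 φ * ‖K r‖)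
    (fun p ↦ (hc.comp (Continuous.prodMk_right p)).aestronglyMeasurable)
    (fun p ↦ .of_forall fun r ↦ ?_) (K.integrable.norm.const_mul _)
    (.of_forall fun r ↦ ?_)
  swap
  · exact hc.comp (f := fun p : ℝ × (Rn n × Rn n) × Rn n ↦ (p, r)) (by fun_prop)
  rw [norm_mul]
  gcongr
  exact norm_atom_le _ _ _

lemma smoothAtom_zero (φ : 𝓢(Rn n, ℂ)) {K : 𝓢(Rn n, ℂ)} (hK : ∫ r, K r = 1) (z : Rn n × Rn n)
    (t : Rn n) : smoothAtom φ K 0 z t = atom φ z t := by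
  simp only [smoothAtom, zero_smul, add_zero]
  rw [integral_const_mul, hK, mul_one]

lemma pairAtom_trans_fourier_cutoff (φ : 𝓢(Rn n, ℂ)) {ψ : Rn n → ℂ} (hψ : IsCutoff ψ) {ρ : ℝ}
    (hρ : 0 < ρ) (z : Rn n × Rn n) (t : Rn n) :
    pairAtom φ z (trans t (𝓕 (cutoff hψ hρ))) =
      smoothAtom φ (𝓕 (cutoff hψ one_pos)) ρ z t := by
  rw [pairAtom, smoothAtom, ← integral_mul_fourier_cutoff hψ hρ (fun r ↦ atom φ z (t + r)),
    ← integral_add_left_eq_self _ t]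
  simp

end SmoothedAtom

/-! ### Decay of products of two atoms tested on Schwartz functions. -/

section TripleProduct

/-- The pairing of a Schwartz function with the product of two smoothed atoms. -/
def tripleSmooth (φ K : 𝓢(Rn n, ℂ)) (ρ : ℝ) (z z' : Rn n × Rn n) (Φ : 𝓢(Rn n, ℂ)) : ℂ :=
  ∫ t, Φ t * (smoothAtom φ K ρ z t * smoothAtom φ K ρ z' t)

/-- The pairing of a Schwartz function with the product of two atoms. -/
def triple (φ : 𝓢(Rn n, ℂ)) (z z' : Rn n × Rn n) (Φ : 𝓢(Rn n, ℂ)) : ℂ :=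
  ∫ t, Φ t * (atom φ z t * atom φ z' t)

lemma integrable_mul_atom_mul_atom (φ : 𝓢(Rn n, ℂ)) (z z' : Rn n × Rn n) (Φ : 𝓢(Rn n, ℂ)) :
    Integrable fun t ↦ Φ t * (atom φ z t * atom φ z' t) := by
  refine Integrable.mono' (Φ.integrable.norm.mul_const
    (SchwartzMap.seminorm ℝ 0 0 φ * SchwartzMap.seminorm ℝ 0 0 φ)) ?_ (.of_forall fun t ↦ ?_)
  · have h1 := (continuous_atom φ).comp (Continuous.prodMk_right z)
    have h2 := (continuous_atom φ).comp (Continuous.prodMk_right z')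
    exact (Φ.continuous.mul (h1.mul h2)).aestronglyMeasurable
  · rw [norm_mul, norm_mul]
    gcongr
    · exact norm_atom_le _ _ _
    · exact norm_atom_le _ _ _

/-- By Fubini the pairing averages unsmoothed ones with centres moved by ρ r. For ρ ≤ 1 Peetre
charges at most (1 + |r|)^N per factor, integrable against K, so the constant does not depend on ρ.
-/
lemma exists_norm_tripleSmooth_le (φ K : 𝓢(Rn n, ℂ)) (N : ℕ) : ∃ (m : ℕ) (C : ℝ), 0 ≤ C ∧
    ∀ ρ : ℝ, 0 ≤ ρ → ρ ≤ 1 → ∀ (z z' : Rn n × Rn n) (Φ : 𝓢(Rn n, ℂ)),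
      ‖tripleSmooth φ K ρ z z' Φ‖ ≤
        C * (wt N z.1 * wt N z'.1 * wt N (z.2 + z'.2)) * schwartzSup m Φ := by
  obtain ⟨m, C, hC, h⟩ := exists_norm_integral_trans_mul_trans_le φ φ N
  have hKi : Integrable fun r ↦ (1 + ‖r‖) ^ N * ‖K r‖ := by
    have hK0 := schwartzSup_nonneg (N + (n + 1)) K
    refine Integrable.mono' ((integrable_wt (Nat.lt_succ_self n)).const_mul
      (2 ^ (N + (n + 1)) * schwartzSup (N + (n + 1)) K)) ?_ (.of_forall fun r ↦ ?_)
    · have := K.continuous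
      exact Continuous.aestronglyMeasurable (by fun_prop)
    · rw [Real.norm_of_nonneg (by positivity)]
      calc _ ≤ (1 + ‖r‖) ^ N * (2 ^ (N + (n + 1)) * schwartzSup (N + (n + 1)) K *
            wt (N + (n + 1)) r) := by gcongr; exact norm_le_wt _ _ _
        _ = 2 ^ (N + (n + 1)) * schwartzSup (N + (n + 1)) K *
            ((1 + ‖r‖) ^ N * wt (N + (n + 1)) r) := by ring
        _ = _ := by rw [pow_mul_wt_add]
  set I := ∫ r, (1 + ‖r‖) ^ N * ‖K r‖ with hI
  have hI0 : 0 ≤ I := integral_nonneg fun r ↦ by positivity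
  refine ⟨m, C * (I * I), by positivity, fun ρ hρ0 hρ1 z z' Φ ↦ ?_⟩
  set B := SchwartzMap.seminorm ℝ 0 0 φ with hB
  have hB0 : 0 ≤ B := apply_nonneg _ _
  set k : Rn n → Rn n × Rn n → ℂ := fun t r ↦
    Φ t * ((atom φ z (t + ρ • r.1) * K r.1) * (atom φ z' (t + ρ • r.2) * K r.2)) with hk
  have hkc : Continuous (Function.uncurry k) := by
    have h1 := (continuous_atom φ).comp (f := fun q : Rn n × Rn n × Rn n ↦
      (z, q.1 + ρ • q.2.1)) (by fun_prop)
    have h2 := (continuous_atom φ).comp (f := fun q : Rn n × Rn n × Rn n ↦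
      (z', q.1 + ρ • q.2.2)) (by fun_prop)
    have h3 := K.continuous
    have h4 := Φ.continuous
    exact (h4.comp continuous_fst).mul ((h1.mul (h3.comp (by fun_prop))).mul
      (h2.mul (h3.comp (by fun_prop))))
  have hki : Integrable (Function.uncurry k) := by
    refine Integrable.mono' ((Φ.integrable.norm.const_mul (B * B)).mul_prod
      (K.integrable.norm.mul_prod K.integrable.norm)) hkc.aestronglyMeasurable
      (.of_forall fun q ↦ ?_)
    have h1 := norm_atom_le φ z (q.1 + ρ • q.2.1)
    have h2 := norm_atom_le φ z' (q.1 + ρ • q.2.2)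
    simp only [Function.uncurry, hk, norm_mul]
    calc _ ≤ ‖Φ q.1‖ * ((B * ‖K q.2.1‖) * (B * ‖K q.2.2‖)) := by gcongr
      _ = _ := by ring
  have h1 : tripleSmooth φ K ρ z z' Φ = ∫ r : Rn n × Rn n, ∫ t, k t r := by
    rw [← integral_integral_swap hki, tripleSmooth]
    refine integral_congr_ae (.of_forall fun t ↦ ?_)
    simp only [hk, smoothAtom]
    rw [integral_const_mul]
    congr 1
    exact (integral_prod_mul (μ := (volume : Measure (Rn n))) (ν := (volume : Measure (Rn n)))
      (fun r ↦ atom φ z (t + ρ • r) * K r) (fun r ↦ atom φ z' (t + ρ • r) * K r)).symm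
  have hw : ∀ (y r : Rn n), wt N (y - ρ • r) ≤ (1 + ‖r‖) ^ N * wt N y := by
    intro y r
    have h2 := wt_le_pow_mul_wt_add N (y - ρ • r) (ρ • r)
    rw [sub_add_cancel] at h2
    refine h2.trans ?_
    have h3 := wt_nonneg N y
    gcongr
    rw [norm_smul, Real.norm_of_nonneg hρ0]
    exact mul_le_of_le_one_left (norm_nonneg _) hρ1
  have hinner : ∀ r : Rn n × Rn n, ‖∫ t, k t r‖ ≤
      (C * (wt N z.1 * wt N z'.1 * wt N (z.2 + z'.2)) * schwartzSup m Φ) *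
        (((1 + ‖r.1‖) ^ N * ‖K r.1‖) * ((1 + ‖r.2‖) ^ N * ‖K r.2‖)) := by
    intro r
    have h2 : ∫ t, k t r = (wave z.2 (ρ • r.1) * K r.1 * (wave z'.2 (ρ • r.2) * K r.2)) *
        ∫ t, φ (t - (z.1 - ρ • r.1)) * φ (t - (z'.1 - ρ • r.2)) * wave (z.2 + z'.2) t * Φ t := by
      rw [← integral_const_mul]
      refine integral_congr_ae (.of_forall fun t ↦ ?_)
      simp only [hk, atom, wave_add_left, wave_add_right]
      rw [show t + ρ • r.1 - z.1 = t - (z.1 - ρ • r.1) by abel,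
        show t + ρ • r.2 - z'.1 = t - (z'.1 - ρ • r.2) by abel]
      ring
    rw [h2]
    simp only [norm_mul, norm_wave, one_mul]
    have h3 := wt_nonneg N (z.2 + z'.2)
    have h4 := schwartzSup_nonneg m Φ
    have h5 := wt_nonneg N z.1
    have h6 := wt_nonneg N (z'.1 - ρ • r.2)
    calc _ ≤ ‖K r.1‖ * ‖K r.2‖ * (C * (wt N (z.1 - ρ • r.1) * wt N (z'.1 - ρ • r.2) *
          wt N (z.2 + z'.2)) * schwartzSup m Φ) := by gcongr; exact h _ _ _ _
      _ ≤ ‖K r.1‖ * ‖K r.2‖ * (C * (((1 + ‖r.1‖) ^ N * wt N z.1) *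
          ((1 + ‖r.2‖) ^ N * wt N z'.1) * wt N (z.2 + z'.2)) * schwartzSup m Φ) := by
          gcongr
          · exact hw _ _
          · exact hw _ _
      _ = _ := by ring
  rw [h1]
  refine (norm_integral_le_of_norm_le ((hKi.mul_prod hKi).const_mul _)
    (.of_forall hinner)).trans_eq ?_
  rw [integral_const_mul, integral_prod_mul (μ := (volume : Measure (Rn n)))
    (ν := (volume : Measure (Rn n))) (fun r ↦ (1 + ‖r‖) ^ N * ‖K r‖)
    (fun r ↦ (1 + ‖r‖) ^ N * ‖K r‖), ← hI]
  ring

lemma exists_norm_triple_le (φ : 𝓢(Rn n, ℂ)) (N : ℕ) : ∃ (m : ℕ) (C : ℝ), 0 ≤ C ∧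
    ∀ (z z' : Rn n × Rn n) (Φ : 𝓢(Rn n, ℂ)), ‖triple φ z z' Φ‖ ≤
      C * (wt N z.1 * wt N z'.1 * wt N (z.2 + z'.2)) * schwartzSup m Φ := by
  obtain ⟨m, C, hC, h⟩ := exists_norm_integral_trans_mul_trans_le φ φ N
  refine ⟨m, C, hC, fun z z' Φ ↦ ?_⟩
  have h1 : triple φ z z' Φ =
      ∫ t, φ (t - z.1) * φ (t - z'.1) * wave (z.2 + z'.2) t * Φ t := by
    refine integral_congr_ae (.of_forall fun t ↦ ?_)
    simp only [atom, wave_add_left]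
    ring
  rw [h1]
  exact h _ _ _ _

/-- Translating by x and merging the exponentials reduces to the fixed test function `conjS φ`, with
centres y - x, y' - x and frequency η + η' - ξ. -/
lemma exists_norm_triple_timeFreqShift_le (φ : 𝓢(Rn n, ℂ)) (N : ℕ) : ∃ C : ℝ, 0 ≤ C ∧
    ∀ (z z' : Rn n × Rn n) (x ξ : Rn n), ‖triple φ z z' (timeFreqShift φ x ξ)‖ ≤
      C * (wt N (z.1 - x) * wt N (z'.1 - x) * wt N (z.2 + z'.2 - ξ)) := by
  obtain ⟨m, C, hC, h⟩ := exists_norm_integral_trans_mul_trans_le φ φ N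
  have h0 := schwartzSup_nonneg m (conjS φ)
  refine ⟨C * schwartzSup m (conjS φ), by positivity, fun z z' x ξ ↦ ?_⟩
  have h1 : triple φ z z' (timeFreqShift φ x ξ) = wave (z.2 + z'.2 - ξ) x *
      ∫ t, φ (t - (z.1 - x)) * φ (t - (z'.1 - x)) * wave (z.2 + z'.2 - ξ) t * conjS φ t := by
    rw [triple, ← integral_const_mul, ← integral_add_right_eq_self _ x]
    refine integral_congr_ae (.of_forall fun t ↦ ?_)
    simp only [timeFreqShift_apply_wave, atom, add_sub_cancel_right, sub_eq_add_neg (z.2 + z'.2),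
      wave_add_left, wave_add_right]
    rw [show t + x - z.1 = t - (z.1 - x) by abel, show t + x - z'.1 = t - (z'.1 - x) by abel]
    ring
  rw [h1, norm_mul, norm_wave, one_mul]
  exact (h _ _ _ _).trans_eq (by ring)

lemma continuous_tripleSmooth (φ K Φ : 𝓢(Rn n, ℂ)) :
    Continuous fun q : ℝ × (Rn n × Rn n) × (Rn n × Rn n) ↦
      tripleSmooth φ K q.1 q.2.1 q.2.2 Φ := by
  set B := SchwartzMap.seminorm ℝ 0 0 φ * ∫ r, ‖K r‖
  have hc : Continuous fun w : (ℝ × (Rn n × Rn n) × (Rn n × Rn n)) × Rn n ↦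
      Φ w.2 * (smoothAtom φ K w.1.1 w.1.2.1 w.2 * smoothAtom φ K w.1.1 w.1.2.2 w.2) := by
    have h1 := (continuous_smoothAtom φ K).comp
      (f := fun w : (ℝ × (Rn n × Rn n) × (Rn n × Rn n)) × Rn n ↦ (w.1.1, w.1.2.1, w.2))
      (by fun_prop)
    have h2 := (continuous_smoothAtom φ K).comp
      (f := fun w : (ℝ × (Rn n × Rn n) × (Rn n × Rn n)) × Rn n ↦ (w.1.1, w.1.2.2, w.2))
      (by fun_prop)
    exact (Φ.continuous.comp continuous_snd).mul (h1.mul h2)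
  refine continuous_of_dominated (bound := fun t ↦ ‖Φ t‖ * (B * B))
    (fun p ↦ (hc.comp (Continuous.prodMk_right p)).aestronglyMeasurable)
    (fun p ↦ .of_forall fun t ↦ ?_) (Φ.integrable.norm.mul_const _)
    (.of_forall fun t ↦ hc.comp (Continuous.prodMk_left t))
  have h1 := norm_smoothAtom_le φ K p.1 p.2.1 t
  have h2 := norm_smoothAtom_le φ K p.1 p.2.2 t
  rw [norm_mul, norm_mul]
  gcongr

lemma tripleSmooth_zero (φ : 𝓢(Rn n, ℂ)) {K : 𝓢(Rn n, ℂ)} (hK : ∫ r, K r = 1)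
    (z z' : Rn n × Rn n) (Φ : 𝓢(Rn n, ℂ)) : tripleSmooth φ K 0 z z' Φ = triple φ z z' Φ := by
  simp only [tripleSmooth, triple, smoothAtom_zero φ hK]

lemma continuous_triple (φ Φ : 𝓢(Rn n, ℂ)) :
    Continuous fun q : (Rn n × Rn n) × (Rn n × Rn n) ↦ triple φ q.1 q.2 Φ := by
  set B := SchwartzMap.seminorm ℝ 0 0 φ
  have hc : Continuous fun w : ((Rn n × Rn n) × (Rn n × Rn n)) × Rn n ↦
      Φ w.2 * (atom φ w.1.1 w.2 * atom φ w.1.2 w.2) := by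
    have h1 := (continuous_atom φ).comp
      (f := fun w : ((Rn n × Rn n) × (Rn n × Rn n)) × Rn n ↦ (w.1.1, w.2)) (by fun_prop)
    have h2 := (continuous_atom φ).comp
      (f := fun w : ((Rn n × Rn n) × (Rn n × Rn n)) × Rn n ↦ (w.1.2, w.2)) (by fun_prop)
    exact (Φ.continuous.comp continuous_snd).mul (h1.mul h2)
  refine continuous_of_dominated (bound := fun t ↦ ‖Φ t‖ * (B * B))
    (fun p ↦ (hc.comp (Continuous.prodMk_right p)).aestronglyMeasurable)
    (fun p ↦ .of_forall fun t ↦ ?_) (Φ.integrable.norm.mul_const _)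
    (.of_forall fun t ↦ hc.comp (Continuous.prodMk_left t))
  have h1 := norm_atom_le φ p.1 t
  have h2 := norm_atom_le φ p.2 t
  rw [norm_mul, norm_mul]
  gcongr

end TripleProduct

end ModulationSpace

end

noncomputable section

namespace ModulationSpace

variable {n : ℕ}

/-! ### The product as an absolutely convergent phase-space integral. -/

section ProductDistribution

/-- The dominating function for the phase space representation of a product. -/
def dominant (N : ℕ) (F G : Rn n × Rn n → ℂ) (w : (Rn n × Rn n) × (Rn n × Rn n)) : ℝ :=
  ‖F w.1‖ * ‖G w.2‖ * (wt N w.1.1 * wt N w.2.1 * wt N (w.1.2 + w.2.2))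

variable {F G : Rn n × Rn n → ℂ} {N : ℕ}

/-- By Tonelli the integral of `dominant` is exactly the majorant at the origin. -/
lemma integrable_dominant (hF : Continuous F) (hG : Continuous G) (h : majorant N F G 0 0 < ∞) :
    Integrable (dominant N F G) := by
  have hw := continuous_wt (E := Rn n) N
  have hc : Continuous (dominant N F G) := by
    unfold dominant
    fun_prop
  refine ⟨hc.aestronglyMeasurable, ?_⟩
  rw [HasFiniteIntegral, Measure.volume_eq_prod, lintegral_prod _ hc.measurable.enorm.aemeasurable]
  refine (lintegral_congr fun z ↦ lintegral_congr fun z' ↦ ?_).trans_lt h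
  have h1 := wt_nonneg N z.1
  have h2 := wt_nonneg N z'.1
  have h3 := wt_nonneg N (z.2 + z'.2)
  simp only [dominant, sub_zero]
  rw [Real.enorm_of_nonneg (by positivity), ENNReal.ofReal_mul (by positivity),
    ENNReal.ofReal_mul (by positivity), ENNReal.ofReal_mul (by positivity),
    ENNReal.ofReal_mul (by positivity), ofReal_norm, ofReal_norm]
  rfl

lemma norm_mul_mul_le_dominant {z z' : Rn n × Rn n} {a : ℂ} {C D : ℝ}
    (h : ‖a‖ ≤ C * (wt N z.1 * wt N z'.1 * wt N (z.2 + z'.2)) * D) :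
    ‖F z * G z' * a‖ ≤ C * D * dominant N F G (z, z') := by
  rw [norm_mul, norm_mul, dominant]
  calc _ ≤ ‖F z‖ * ‖G z'‖ * (C * (wt N z.1 * wt N z'.1 * wt N (z.2 + z'.2)) * D) := by gcongr
    _ = _ := by ring

lemma integrable_mul_triple (φ : 𝓢(Rn n, ℂ)) (hF : Continuous F) (hG : Continuous G)
    (h : Integrable (dominant N F G)) (Φ : 𝓢(Rn n, ℂ)) :
    Integrable fun w : (Rn n × Rn n) × (Rn n × Rn n) ↦
      F w.1 * G w.2 * triple φ w.1 w.2 Φ := by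
  obtain ⟨m, C, -, hC⟩ := exists_norm_triple_le φ N
  have ht := continuous_triple φ Φ
  refine Integrable.mono' (h.const_mul (C * schwartzSup m Φ))
    (Continuous.aestronglyMeasurable (by fun_prop))
    (.of_forall fun w ↦ norm_mul_mul_le_dominant (hC _ _ _))

lemma exists_distribution (φ : 𝓢(Rn n, ℂ)) (hF : Continuous F) (hG : Continuous G)
    (h : Integrable (dominant N F G)) : ∃ H : 𝓢'(Rn n, ℂ), ∀ Φ : 𝓢(Rn n, ℂ),
      H Φ = ∫ w : (Rn n × Rn n) × (Rn n × Rn n), F w.1 * G w.2 * triple φ w.1 w.2 Φ := by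
  obtain ⟨m, C, hC0, hC⟩ := exists_norm_triple_le φ N
  have hD : 0 ≤ ∫ w, dominant N F G w := integral_nonneg fun w ↦ by
    have h1 := wt_nonneg N w.1.1
    have h2 := wt_nonneg N w.2.1
    have h3 := wt_nonneg N (w.1.2 + w.2.2)
    simp only [dominant, Pi.zero_apply]
    positivity
  let L : 𝓢(Rn n, ℂ) →L[ℂ] ℂ := SchwartzMap.mkCLMtoNormedSpace
    (fun Φ ↦ ∫ w : (Rn n × Rn n) × (Rn n × Rn n), F w.1 * G w.2 * triple φ w.1 w.2 Φ)
    (fun Φ Ψ ↦ by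
      rw [← integral_add (integrable_mul_triple φ hF hG h Φ) (integrable_mul_triple φ hF hG h Ψ)]
      refine integral_congr_ae (.of_forall fun w ↦ ?_)
      simp only [triple, add_apply, add_mul]
      rw [integral_add (integrable_mul_atom_mul_atom φ _ _ Φ)
        (integrable_mul_atom_mul_atom φ _ _ Ψ), mul_add])
    (fun a Φ ↦ by
      rw [RingHom.id_apply, smul_eq_mul, ← integral_const_mul]
      refine integral_congr_ae (.of_forall fun w ↦ ?_)
      simp only [triple, _root_.smul_apply, smul_eq_mul, mul_assoc]
      rw [integral_const_mul]
      ring)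
    ⟨Finset.Iic (m, m), C * ∫ w, dominant N F G w, by positivity, fun Φ ↦ by
      refine (norm_integral_le_of_norm_le (h.const_mul (C * schwartzSup m Φ))
        (.of_forall fun w ↦ norm_mul_mul_le_dominant (hC _ _ _))).trans_eq ?_
      rw [integral_const_mul, schwartzSup]
      ring⟩
  exact ⟨ContinuousLinearMap.toPointwiseConvergenceCLM _ _ _ _ L, fun Φ ↦ rfl⟩

end ProductDistribution

/-! ### Convergence of S^j f · S^j g. -/

section Approximation

lemma exists_norm_stft_mul_pairAtom_trans_le (φ : 𝓢(Rn n, ℂ)) (f : 𝓢'(Rn n, ℂ))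
    (κ : 𝓢(Rn n, ℂ)) : ∃ (m : ℕ) (A : ℝ), 0 ≤ A ∧ ∀ (z : Rn n × Rn n) (t : Rn n),
      ‖stft φ f z.1 z.2 * pairAtom φ z (trans t κ)‖ ≤
        A * (1 + ‖t‖) ^ m * (wt (n + 1) z.1 * wt (n + 1) z.2) := by
  obtain ⟨M, C, hC, h⟩ := norm_stft_le φ f
  obtain ⟨m, C', hC', h'⟩ := exists_norm_pairAtom_le φ (M + (n + 1))
  have h0 := schwartzSup_nonneg m κ
  refine ⟨m, C * C' * (2 ^ m * schwartzSup m κ), by positivity, fun z t ↦ ?_⟩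
  have h1 := wt_nonneg (M + (n + 1)) z.1
  have h2 := wt_nonneg (M + (n + 1)) z.2
  rw [norm_mul]
  calc _ ≤ C * ((1 + ‖z.1‖) ^ M * (1 + ‖z.2‖) ^ M) *
        (C' * (wt (M + (n + 1)) z.1 * wt (M + (n + 1)) z.2) *
          (2 ^ m * (1 + ‖t‖) ^ m * schwartzSup m κ)) := by
        gcongr
        · exact h z
        · refine (h' _ _).trans ?_
          gcongr
          exact schwartzSup_trans_le m t κ
    _ = C * C' * (2 ^ m * schwartzSup m κ) * (1 + ‖t‖) ^ m *
        (((1 + ‖z.1‖) ^ M * wt (M + (n + 1)) z.1) * ((1 + ‖z.2‖) ^ M * wt (M + (n + 1)) z.2)) := by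
        ring
    _ = _ := by rw [pow_mul_wt_add, pow_mul_wt_add]

/-- Inserts the inversion formula into both factors. With ρ > 0 fixed, the kernel κ is Schwartz and
crude polynomial bounds on the transforms justify Fubini for arbitrary f and g. -/
lemma integral_mul_corr_mul_corr {φ : 𝓢(Rn n, ℂ)} {c : ℂ} (hc : ∀ (f : 𝓢'(Rn n, ℂ))
    (G : 𝓢(Rn n, ℂ)), f G = c * ∫ z : Rn n × Rn n, stft φ f z.1 z.2 * pairAtom φ z G)
    (f g : 𝓢'(Rn n, ℂ)) {ψ : Rn n → ℂ} (hψ : IsCutoff ψ) {ρ : ℝ} (hρ : 0 < ρ) (Φ : 𝓢(Rn n, ℂ)) :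
    ∫ t, Φ t * (corr f (𝓕 (cutoff hψ hρ)) t * corr g (𝓕 (cutoff hψ hρ)) t) =
      c ^ 2 * ∫ w : (Rn n × Rn n) × (Rn n × Rn n), stft φ f w.1.1 w.1.2 * stft φ g w.2.1 w.2.2 *
        tripleSmooth φ (𝓕 (cutoff hψ one_pos)) ρ w.1 w.2 Φ := by
  set κ : 𝓢(Rn n, ℂ) := 𝓕 (cutoff hψ hρ) with hκ
  set K : 𝓢(Rn n, ℂ) := 𝓕 (cutoff hψ one_pos) with hK
  obtain ⟨m₁, A₁, hA₁, h₁⟩ := exists_norm_stft_mul_pairAtom_trans_le φ f κ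
  obtain ⟨m₂, A₂, hA₂, h₂⟩ := exists_norm_stft_mul_pairAtom_trans_le φ g κ
  set W : Rn n × Rn n → ℝ := fun z ↦ wt (n + 1) z.1 * wt (n + 1) z.2 with hW
  have hWi : Integrable W := integrable_wt_mul_wt (Nat.lt_succ_self n)
  set k : Rn n → (Rn n × Rn n) × (Rn n × Rn n) → ℂ := fun t w ↦
    Φ t * ((stft φ f w.1.1 w.1.2 * smoothAtom φ K ρ w.1 t) *
      (stft φ g w.2.1 w.2.2 * smoothAtom φ K ρ w.2 t)) with hk
  have hpair : ∀ z t, smoothAtom φ K ρ z t = pairAtom φ z (trans t κ) := fun z t ↦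
    (pairAtom_trans_fourier_cutoff φ hψ hρ z t).symm
  have hkc : Continuous (Function.uncurry k) := by
    have e1 : Continuous fun q : Rn n × (Rn n × Rn n) × (Rn n × Rn n) ↦
        smoothAtom φ K ρ q.2.1 q.1 := (continuous_smoothAtom φ K).comp
      (f := fun q : Rn n × (Rn n × Rn n) × (Rn n × Rn n) ↦ (ρ, q.2.1, q.1)) (by fun_prop)
    have e2 : Continuous fun q : Rn n × (Rn n × Rn n) × (Rn n × Rn n) ↦
        smoothAtom φ K ρ q.2.2 q.1 := (continuous_smoothAtom φ K).comp
      (f := fun q : Rn n × (Rn n × Rn n) × (Rn n × Rn n) ↦ (ρ, q.2.2, q.1)) (by fun_prop)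
    have e3 : Continuous fun q : Rn n × (Rn n × Rn n) × (Rn n × Rn n) ↦
        stft φ f q.2.1.1 q.2.1.2 := (continuous_stft φ f).comp
      (f := fun q : Rn n × (Rn n × Rn n) × (Rn n × Rn n) ↦ q.2.1) (by fun_prop)
    have e4 : Continuous fun q : Rn n × (Rn n × Rn n) × (Rn n × Rn n) ↦
        stft φ g q.2.2.1 q.2.2.2 := (continuous_stft φ g).comp
      (f := fun q : Rn n × (Rn n × Rn n) × (Rn n × Rn n) ↦ q.2.2) (by fun_prop)
    exact (Φ.continuous.comp continuous_fst).mul ((e3.mul e1).mul (e4.mul e2))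
  have hki : Integrable (Function.uncurry k) := by
    -- The two factors grow like |t|^{m₁} and |t|^{m₂}; Φ must absorb both and leave n + 1 powers
    -- for integrability.
    set D := A₁ * A₂ * (2 ^ (m₁ + m₂ + (n + 1)) * schwartzSup (m₁ + m₂ + (n + 1)) Φ)
    refine Integrable.mono' (((integrable_wt (Nat.lt_succ_self n)).const_mul D).mul_prod
      (hWi.mul_prod hWi)) hkc.aestronglyMeasurable (.of_forall fun q ↦ ?_)
    have h3 := norm_le_wt (m₁ + m₂ + (n + 1)) Φ q.1
    have h4 := h₁ q.2.1 q.1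
    have h5 := h₂ q.2.2 q.1
    rw [← hpair] at h4 h5
    simp only [Function.uncurry, hk]
    rw [norm_mul, norm_mul]
    calc _ ≤ (2 ^ (m₁ + m₂ + (n + 1)) * schwartzSup (m₁ + m₂ + (n + 1)) Φ *
          wt (m₁ + m₂ + (n + 1)) q.1) * ((A₁ * (1 + ‖q.1‖) ^ m₁ * W q.2.1) *
            (A₂ * (1 + ‖q.1‖) ^ m₂ * W q.2.2)) := by
          have h6 := (norm_nonneg _).trans h3
          have h7 := (norm_nonneg _).trans h4
          gcongr
      _ = D * ((1 + ‖q.1‖) ^ (m₁ + m₂) * wt (m₁ + m₂ + (n + 1)) q.1) * (W q.2.1 * W q.2.2) := by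
          ring
      _ = _ := by rw [pow_mul_wt_add]
  have hcorr : ∀ t, Φ t * (corr f κ t * corr g κ t) = c ^ 2 * ∫ w, k t w := by
    intro t
    simp only [corr, hk]
    rw [hc f, hc g, integral_const_mul, Measure.volume_eq_prod (Rn n × Rn n) (Rn n × Rn n),
      integral_prod_mul (fun z : Rn n × Rn n ↦ stft φ f z.1 z.2 * smoothAtom φ K ρ z t)
        (fun z : Rn n × Rn n ↦ stft φ g z.1 z.2 * smoothAtom φ K ρ z t)]
    simp only [hpair]
    ring
  simp_rw [hcorr]
  rw [integral_const_mul, integral_integral_swap hki]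
  congr 1
  refine integral_congr_ae (.of_forall fun w ↦ ?_)
  simp only [hk, tripleSmooth]
  rw [← integral_const_mul]
  refine integral_congr_ae (.of_forall fun t ↦ ?_)
  ring

/-- Dominated convergence: the bound uniform in 0 ≤ ρ ≤ 1 supplies `dominant`, and continuity at ρ =
0 the pointwise limit. -/
lemma tendsto_integral_tripleSmooth {F G : Rn n × Rn n → ℂ} {N : ℕ} (φ : 𝓢(Rn n, ℂ))
    {K : 𝓢(Rn n, ℂ)} (hK : ∫ r, K r = 1) (hF : Continuous F) (hG : Continuous G)
    (h : Integrable (dominant N F G)) (Φ : 𝓢(Rn n, ℂ)) :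
    Tendsto (fun j : ℕ ↦ ∫ w : (Rn n × Rn n) × (Rn n × Rn n), F w.1 * G w.2 *
      tripleSmooth φ K ((2 : ℝ) ^ j)⁻¹ w.1 w.2 Φ) atTop
      (𝓝 (∫ w : (Rn n × Rn n) × (Rn n × Rn n), F w.1 * G w.2 * triple φ w.1 w.2 Φ)) := by
  obtain ⟨m, C, -, hC⟩ := exists_norm_tripleSmooth_le φ K N
  have hc := continuous_tripleSmooth φ K Φ
  refine tendsto_integral_of_dominated_convergence
    (fun w ↦ C * schwartzSup m Φ * dominant N F G w) (fun j ↦ ?_) (h.const_mul _) (fun j ↦ ?_) ?_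
  · have h1 := hc.comp (f := fun w : (Rn n × Rn n) × (Rn n × Rn n) ↦ (((2 : ℝ) ^ j)⁻¹, w))
      (by fun_prop)
    exact (((hF.comp continuous_fst).mul (hG.comp continuous_snd)).mul h1).aestronglyMeasurable
  · refine .of_forall fun w ↦ norm_mul_mul_le_dominant (hC _ (by positivity) ?_ _ _ _)
    exact inv_le_one_of_one_le₀ (one_le_pow₀ (by norm_num))
  · refine .of_forall fun w ↦ Tendsto.const_mul _ ?_
    rw [← tripleSmooth_zero φ hK]
    have h1 : Continuous fun ρ : ℝ ↦ tripleSmooth φ K ρ w.1 w.2 Φ :=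
      hc.comp (f := fun ρ : ℝ ↦ (ρ, w)) (by fun_prop)
    have h2 : Tendsto (fun j : ℕ ↦ ((2 : ℝ) ^ j)⁻¹) atTop (𝓝 0) :=
      (tendsto_pow_atTop_atTop_of_one_lt one_lt_two).inv_tendsto_atTop
    exact (h1.tendsto 0).comp h2

lemma isProduct_of_forall_eq {φ : 𝓢(Rn n, ℂ)} {c : ℂ} (hc : ∀ (f : 𝓢'(Rn n, ℂ))
    (G : 𝓢(Rn n, ℂ)), f G = c * ∫ z : Rn n × Rn n, stft φ f z.1 z.2 * pairAtom φ z G) {N : ℕ}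
    {f g h : 𝓢'(Rn n, ℂ)}
    (hD : Integrable (dominant N (fun z ↦ stft φ f z.1 z.2) fun z ↦ stft φ g z.1 z.2))
    (hh : ∀ Φ : 𝓢(Rn n, ℂ), h Φ = c ^ 2 * ∫ w : (Rn n × Rn n) × (Rn n × Rn n),
      stft φ f w.1.1 w.1.2 * stft φ g w.2.1 w.2.2 * triple φ w.1 w.2 Φ)
    {ψ : Rn n → ℂ} (hψ : IsCutoff ψ) : IsProduct ψ f g h := by
  have hρ : ∀ j : ℕ, 0 < ((2 : ℝ) ^ j)⁻¹ := fun j ↦ by positivity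
  refine ⟨fun j ↦ corr f (𝓕 (cutoff hψ (hρ j))), fun j ↦ corr g (𝓕 (cutoff hψ (hρ j))),
    fun j ↦ hasTemperateGrowth_corr _ _, fun j ↦ hasTemperateGrowth_corr _ _,
    fun j ↦ lowPass_eq hψ (hρ j) f, fun j ↦ lowPass_eq hψ (hρ j) g, ?_⟩
  rw [PointwiseConvergenceCLM.tendsto_iff_forall_tendsto]
  intro Φ
  rw [hh]
  refine Tendsto.congr (fun j ↦ (integral_mul_corr_mul_corr hc f g hψ (hρ j) Φ).symm) ?_
  exact (tendsto_integral_tripleSmooth φ (integral_fourier_cutoff hψ) (continuous_stft φ f)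
    (continuous_stft φ g) hD Φ).const_mul _

end Approximation

/-! ### The norm estimate and the Dirac distribution. -/

section Estimate

/-- Take a shifted window as test function in the phase-space integral and apply the decay of
`triple`. -/
lemma exists_enorm_stft_le (φ : 𝓢(Rn n, ℂ)) (c : ℂ) (N : ℕ) : ∃ C : ℝ≥0,
    ∀ (F G : Rn n × Rn n → ℂ), ∀ h : 𝓢'(Rn n, ℂ), Continuous F → Continuous G →
      (∀ Φ : 𝓢(Rn n, ℂ), h Φ = c * ∫ w : (Rn n × Rn n) × (Rn n × Rn n),
        F w.1 * G w.2 * triple φ w.1 w.2 Φ) →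
      ∀ x ξ, ‖stft φ h x ξ‖ₑ ≤ C * majorant N F G x ξ := by
  obtain ⟨C, hC0, hC⟩ := exists_norm_triple_timeFreqShift_le φ N
  set a : ℂ := (((2 * Real.pi) ^ (-(n : ℝ) / 2) : ℝ) : ℂ) with ha
  refine ⟨‖a‖₊ * ‖c‖₊ * ‖C‖₊, fun F G h hF hG hh x ξ ↦ ?_⟩
  have hw := measurable_ewt (n := n) N
  have hFm := hF.measurable
  have hGm := hG.measurable
  have h1 : ∀ w : (Rn n × Rn n) × (Rn n × Rn n),
      ‖F w.1 * G w.2 * triple φ w.1 w.2 (timeFreqShift φ x ξ)‖ₑ ≤ ‖C‖ₑ * (‖F w.1‖ₑ * ‖G w.2‖ₑ *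
        (ewt N (w.1.1 - x) * ewt N (w.2.1 - x) * ewt N (w.1.2 + w.2.2 - ξ))) := by
    intro w
    have h2 := ENNReal.ofReal_le_ofReal (hC w.1 w.2 x ξ)
    have h3 := wt_nonneg N (w.1.1 - x)
    have h4 := wt_nonneg N (w.2.1 - x)
    rw [ofReal_norm, ENNReal.ofReal_mul hC0, ENNReal.ofReal_mul (by positivity),
      ENNReal.ofReal_mul (by positivity), ← Real.enorm_of_nonneg hC0] at h2
    rw [enorm_mul, enorm_mul]
    calc _ ≤ _ := mul_le_mul_right h2 _
      _ = _ := by simp only [ewt]; ring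
  rw [stft, ← ha, hh, enorm_mul, enorm_mul]
  push_cast
  rw [mul_assoc, mul_assoc]
  refine mul_le_mul_right (mul_le_mul_right ?_ _) _
  calc _ ≤ ∫⁻ w : (Rn n × Rn n) × (Rn n × Rn n), ‖C‖ₑ * (‖F w.1‖ₑ * ‖G w.2‖ₑ *
        (ewt N (w.1.1 - x) * ewt N (w.2.1 - x) * ewt N (w.1.2 + w.2.2 - ξ))) :=
        (enorm_integral_le_lintegral_enorm _).trans (lintegral_mono h1)
    _ = _ := by
        rw [lintegral_const_mul _ (by fun_prop),
          Measure.volume_eq_prod (Rn n × Rn n) (Rn n × Rn n), lintegral_prod _ (by fun_prop)]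
        rfl

lemma mixedNorm_le_const_mul {s : ℝ} {p q : ℝ≥0∞} (hp : 1 ≤ p) (hq : 1 ≤ q)
    {F H : Rn n × Rn n → ℝ≥0∞} (hH : Measurable H) (c : ℝ≥0∞) (h : ∀ z, F z ≤ c * H z) :
    mixedNorm s p q F ≤ c * mixedNorm s p q H := by
  have hb : Measurable fun ξ : Rn n ↦ ENNReal.ofReal (bracket ξ ^ s) :=
    (continuous_bracket_rpow s).measurable.ennreal_ofReal
  have hm := measurable_eLpNorm_left (μ := (volume : Measure (Rn n))) (F := fun x ξ ↦ H (x, ξ))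
    hH p
  rw [mixedNorm, mixedNorm, ← eLpNorm_const_mul_ennreal (by fun_prop) _ hq]
  refine eLpNorm_mono_enorm fun ξ ↦ ?_
  simp only [enorm_eq_self]
  rw [mul_left_comm, ← eLpNorm_const_mul_ennreal (f := fun x ↦ H (x, ξ))
    (hH.comp measurable_prodMk_right) _ hp]
  gcongr
  exact eLpNorm_mono_enorm fun x ↦ h (x, ξ)

/-- The multiplication theorem for modulation spaces. -/
theorem exists_product_estimate {φ : 𝓢(Rn n, ℂ)} (hφ : φ ≠ 0) {p p₁ p₂ q : ℝ≥0∞} {s : ℝ}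
    (hp : 1 ≤ p) (hq : 1 ≤ q) (hpp : p⁻¹ = p₁⁻¹ + p₂⁻¹) (hs : s ≤ 0) :
    ∃ c : ℝ≥0, ∀ f g : 𝓢'(Rn n, ℂ), MemMod φ |s| p₁ 1 f → MemMod φ s p₂ q g →
      ∃ h : 𝓢'(Rn n, ℂ), (∀ ψ, IsCutoff ψ → IsProduct ψ f g h) ∧ MemMod φ s p q h ∧
        modNorm φ s p q h ≤ c * modNorm φ |s| p₁ 1 f * modNorm φ s p₂ q g := by
  obtain ⟨a, ha⟩ := exists_stft_inversion hφ
  obtain ⟨N, b, hb⟩ := exists_mixedNorm_majorant_le (n := n) hp hq hpp hs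
  obtain ⟨C, hC⟩ := exists_enorm_stft_le φ (a ^ 2) N
  refine ⟨C * b, fun f g hf hg ↦ ?_⟩
  have hF := continuous_stft φ f
  have hG := continuous_stft φ g
  have hmaj := hb _ _ hF hG
  rw [← modNorm_eq, ← modNorm_eq] at hmaj
  have hfin := ENNReal.mul_lt_top (ENNReal.mul_lt_top (ENNReal.coe_lt_top (r := b)) hf) hg
  -- The norm bound for the majorant comes before the product exists and is what makes its defining
  -- integral converge.
  have hD := integrable_dominant hF hG (majorant_zero_lt_top hp hq hF hG (hmaj.trans_lt hfin))
  obtain ⟨H, hH⟩ := exists_distribution φ hF hG hD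
  have hh : ∀ Φ : 𝓢(Rn n, ℂ), (a ^ 2 • H) Φ = a ^ 2 * ∫ w : (Rn n × Rn n) × (Rn n × Rn n),
      stft φ f w.1.1 w.1.2 * stft φ g w.2.1 w.2.2 * triple φ w.1 w.2 Φ := fun Φ ↦ by
    rw [← hH]
    rfl
  have hle : modNorm φ s p q (a ^ 2 • H) ≤
      (C * b : ℝ≥0) * modNorm φ |s| p₁ 1 f * modNorm φ s p₂ q g := by
    rw [modNorm_eq]
    refine (mixedNorm_le_const_mul hp hq (measurable_majorant N hF hG) C
      fun z ↦ hC _ _ _ hF hG hh z.1 z.2).trans ?_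
    push_cast
    rw [mul_assoc, mul_assoc, ← mul_assoc (b : ℝ≥0∞)]
    gcongr
  refine ⟨a ^ 2 • H, fun ψ hψ ↦ isProduct_of_forall_eq ha hD hh hψ, hle.trans_lt ?_, hle⟩
  exact ENNReal.mul_lt_top (ENNReal.mul_lt_top ENNReal.coe_lt_top hf) hg

lemma eLpNorm_const_top_le (c : ℝ≥0∞) : eLpNorm (fun _ : Rn n ↦ c) ∞ volume ≤ c := by
  rw [eLpNorm_exponent_top, eLpNormEssSup]
  exact essSup_le_of_ae_le _ (.of_forall fun _ ↦ (enorm_eq_self c).le)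

/-- Modulation has modulus one, so the frequency disappears; this is why δ has outer exponent ∞. -/
lemma enorm_stft_delta (φ : 𝓢(Rn n, ℂ)) (x ξ : Rn n) :
    ‖stft φ (TemperedDistribution.delta 0) x ξ‖ₑ =
      ‖(((2 * Real.pi) ^ (-(n : ℝ) / 2) : ℝ) : ℂ)‖ₑ * ‖φ (-x)‖ₑ := by
  have h : ‖timeFreqShift φ x ξ 0‖ = ‖φ (-x)‖ := by
    rw [timeFreqShift_apply_wave, norm_mul, norm_wave, mul_one, zero_sub]
    exact Complex.norm_conj _
  rw [stft, TemperedDistribution.delta_apply, enorm_mul]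
  congr 1
  rw [← ofReal_norm, h, ofReal_norm]

lemma memMod_delta (φ : 𝓢(Rn n, ℂ)) {p : ℝ≥0∞} (hp : 1 ≤ p) :
    MemMod φ 0 p ∞ (TemperedDistribution.delta (0 : Rn n)) := by
  have hφ := φ.continuous
  have hm : Measurable fun x ↦ ‖φ (-x)‖ₑ :=
    (by fun_prop : Continuous fun x ↦ φ (-x)).measurable.enorm
  have h : eLpNorm (fun x ↦ ‖φ (-x)‖ₑ) p volume = eLpNorm φ p volume := by
    rw [eLpNorm_enorm]
    exact eLpNorm_comp_measurePreserving hφ.aestronglyMeasurable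
      (Measure.measurePreserving_neg volume)
  rw [MemMod, modNorm_eq, mixedNorm]
  simp only [Real.rpow_zero, ENNReal.ofReal_one, one_mul, enorm_stft_delta]
  simp only [eLpNorm_const_mul_ennreal hm _ hp, h]
  exact (eLpNorm_const_top_le _).trans_lt
    (ENNReal.mul_lt_top enorm_lt_top (φ.eLpNorm_lt_top p volume))

end Estimate

end ModulationSpace

end

theorem theorem3p11 (n : ℕ) (φ : 𝓢(ModulationSpace.Rn n, ℂ)) (hφ : φ ≠ 0) :
    (∀ (p p₁ p₂ q : ℝ≥0∞) (s : ℝ), 1 ≤ p → 1 ≤ p₁ → 1 ≤ p₂ → 1 ≤ q →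
      p⁻¹ = p₁⁻¹ + p₂⁻¹ → s ≤ 0 →
      ∃ c : ℝ≥0, ∀ f g : 𝓢'(ModulationSpace.Rn n, ℂ),
        ModulationSpace.MemMod φ |s| p₁ 1 f → ModulationSpace.MemMod φ s p₂ q g →
        ∃ h : 𝓢'(ModulationSpace.Rn n, ℂ),
          (∀ ψ, ModulationSpace.IsCutoff ψ → ModulationSpace.IsProduct ψ f g h) ∧
          ModulationSpace.MemMod φ s p q h ∧
          ModulationSpace.modNorm φ s p q h ≤
            c * ModulationSpace.modNorm φ |s| p₁ 1 f * ModulationSpace.modNorm φ s p₂ q g) ∧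
    (∀ p : ℝ≥0∞, 1 ≤ p →
      ModulationSpace.MemMod φ 0 p ∞ (TemperedDistribution.delta (0 : ModulationSpace.Rn n)) ∧
      ∃ c : ℝ≥0, ∀ f : 𝓢'(ModulationSpace.Rn n, ℂ), ModulationSpace.MemMod φ 0 ∞ 1 f →
        ∃ h : 𝓢'(ModulationSpace.Rn n, ℂ),
          (∀ ψ, ModulationSpace.IsCutoff ψ →
            ModulationSpace.IsProduct ψ f (TemperedDistribution.delta 0) h) ∧
          ModulationSpace.MemMod φ 0 p ∞ h ∧
          ModulationSpace.modNorm φ 0 p ∞ h ≤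
            c * ModulationSpace.modNorm φ 0 p ∞
                  (TemperedDistribution.delta (0 : ModulationSpace.Rn n)) *
              ModulationSpace.modNorm φ 0 ∞ 1 f) := by
  refine ⟨fun p p₁ p₂ q s hp _ _ hq hpp hs ↦
    ModulationSpace.exists_product_estimate hφ hp hq hpp hs, fun p hp ↦
    ⟨ModulationSpace.memMod_delta φ hp, ?_⟩⟩
  -- Here s = 0 and p₁ = q = ∞; the Hölder relation holds because ∞⁻¹ = 0.
  obtain ⟨c, hc⟩ := ModulationSpace.exists_product_estimate (n := n) hφ (p := p) (p₁ := ∞)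
    (p₂ := p) (q := ∞) hp le_top (by simp) le_rfl
  rw [abs_zero] at hc
  refine ⟨c, fun f hf ↦ ?_⟩
  obtain ⟨h, h1, h2, h3⟩ := hc f _ hf (ModulationSpace.memMod_delta φ hp)
  exact ⟨h, h1, h2, h3.trans_eq (mul_right_comm _ _ _)⟩
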